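/- Let $n\ge 1$, let $\Omega\subset\mathbb{R}^n$ be a bounded open set and let $p>2$. Consider the Dirichlet problem $$u_t-\Delta_p u=0\ \text{ in }\Omega\times(0,\infty),\qquad u=0\ \text{ on }\partial\Omega\times(0,\infty),\qquad u(0)=u_0\in L^2(\Omega),$$ where $\Delta_p u=\operatorname{div}(|\nabla u|^{p-2}\nabla u)$. A solution is a function $u\in C([0,\infty);L^2(\Omega))\cap L^p_{\mathrm{loc}}([0,\infty);W^{1,p}_0(\Omega))$ with $u(0)=u_0$ such that for every $v\in C_c^\infty(\Omega)$ and all $0\le s\le t$, $$\int_\Omega u(t)v\,dx-\int_\Omega u(s)v\,dx+\int_s^t\!\int_\Omega|\nabla u|^{p-2}\nabla u\cdot\nabla v\,dx\,d\tau=0 .$$ Put $E(t)=\tfrac12\|u(t)\|_{L^2(\Omega)}^2$. Then there are constants $C_1,C_2,C_3>0$, depending only on $p$ and $\Omega$, such that for every $u_0\in L^2(\Omega)$ and every solution $u$ with initial value $u_0$, the following hold for all $t>0$: $E$ is differentiable at $t$, $$E'(t)+C_1E(t)^{p/2}\le 0,\qquad E(t)\le C_2\,t^{-2/(p-2)},\qquad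 \|u(t)\|_{L^2(\Omega)}\le C_3\,t^{-1/(p-2)}.$$ -/

import Mathlib

open MeasureTheory Filter Topology Set TopologicalSpace
open scoped Distributions

noncomputable section

/-- `f` belongs to the Sobolev space `W₀^{1,p}(Ω)` and `g` is its weak gradient: `(f, g)` lies in
`Lᵖ(Ω) × Lᵖ(Ω; ℝⁿ)` and is the limit there of the pairs `(φ, ∇φ)` for a sequence of test functions
`φ ∈ C_c^∞(Ω)`; that is, `W₀^{1,p}(Ω)` is the closure of `C_c^∞(Ω)` in the `W^{1,p}` norm. -/
structure HasSobolevZeroGradient {n : ℕ} (Ω : Opens (EuclideanSpace ℝ (Fin n))) (p : ℝ)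
    (f : EuclideanSpace ℝ (Fin n) → ℝ)
    (g : EuclideanSpace ℝ (Fin n) → EuclideanSpace ℝ (Fin n)) : Prop where
  memLp : MemLp f (ENNReal.ofReal p) (volume.restrict (Ω : Set (EuclideanSpace ℝ (Fin n))))
  memLp_gradient :
    MemLp g (ENNReal.ofReal p) (volume.restrict (Ω : Set (EuclideanSpace ℝ (Fin n))))
  exists_approx : ∃ φ : ℕ → 𝓓(Ω, ℝ),
    Tendsto (fun k => eLpNorm (fun x => f x - φ k x) (ENNReal.ofReal p)
      (volume.restrict (Ω : Set (EuclideanSpace ℝ (Fin n))))) atTop (𝓝 0) ∧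
    Tendsto (fun k => eLpNorm (fun x => g x - gradient (φ k) x) (ENNReal.ofReal p)
      (volume.restrict (Ω : Set (EuclideanSpace ℝ (Fin n))))) atTop (𝓝 0)

/-- The space `L²(Ω)`. -/
abbrev L2Space {n : ℕ} (Ω : Opens (EuclideanSpace ℝ (Fin n))) : Type :=
  Lp ℝ 2 (volume.restrict (Ω : Set (EuclideanSpace ℝ (Fin n))))

/-- `u` (only its values at times `t ≥ 0` matter) is a weak solution of the Dirichlet problem
`u_t - Δ_p u = 0` in `Ω × (0, ∞)`, `u = 0` on `∂Ω × (0, ∞)`, `u(0) = u₀` in `Ω`: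
`u ∈ C([0,∞); L²(Ω)) ∩ Lᵖ_loc([0,∞); W₀^{1,p}(Ω))`, `u(0) = u₀`, and for every `v ∈ C_c^∞(Ω)`
and all `0 ≤ s ≤ t`,
`∫ u(t) v - ∫ u(s) v + ∫_s^t ∫ |∇u|^{p-2} ∇u · ∇v = 0`.
The function `g` is the spatial gradient `∇u`. -/
structure IsParabolicPLaplaceSolution {n : ℕ} (Ω : Opens (EuclideanSpace ℝ (Fin n))) (p : ℝ)
    (u₀ : L2Space Ω) (u : ℝ → L2Space Ω) : Prop where
  continuousOn : ContinuousOn u (Ici 0)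
  initial : u 0 = u₀
  exists_gradient : ∃ g : ℝ → EuclideanSpace ℝ (Fin n) → EuclideanSpace ℝ (Fin n),
    (∀ T : ℝ, 0 < T → MemLp (fun z : ℝ × EuclideanSpace ℝ (Fin n) => g z.1 z.2)
      (ENNReal.ofReal p) ((volume.restrict (Ioo 0 T)).prod
        (volume.restrict (Ω : Set (EuclideanSpace ℝ (Fin n)))))) ∧
    (∀ᵐ t ∂(volume.restrict (Ioi (0 : ℝ))), HasSobolevZeroGradient Ω p (u t) (g t)) ∧
    ∀ v : 𝓓(Ω, ℝ), ∀ s t : ℝ, 0 ≤ s → s ≤ t →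
      (∫ x in (Ω : Set (EuclideanSpace ℝ (Fin n))), u t x * v x)
        - (∫ x in (Ω : Set (EuclideanSpace ℝ (Fin n))), u s x * v x)
        + ∫ τ in s..t, ∫ x in (Ω : Set (EuclideanSpace ℝ (Fin n))),
            ‖g τ x‖ ^ (p - 2) * inner ℝ (g τ x) (gradient v x) = 0

/-- The energy `E(t) = ½ ‖u(t)‖²` in `L²(Ω)`. -/
def l2Energy {n : ℕ} {Ω : Opens (EuclideanSpace ℝ (Fin n))} (u : ℝ → L2Space Ω) (t : ℝ) : ℝ :=
  1 / 2 * ‖u t‖ ^ 2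

end

/-! Formally, testing the equation with `u` gives `E' = -D`, where `D(t) = ∫ ‖∇u(t)‖ ^ p`, and
Poincaré's inequality gives `D ≥ κ E ^ (p / 2)`; integrating this differential inequality yields the
decay. Two points need work: `u` is not an admissible test function, and the integrated identity
alone gives `E'` only at almost every time.

The energy identity (`WeakEvolution.energy_identity`) comes from testing with the frozen function `w
τ`, which lies in the Sobolev space for a.e. `τ`, on the interval between `τ` and `τ + r`. Since `⟪w
(τ + r) - w τ, w τ⟫ ≤ ½‖w (τ + r)‖² - ½‖w τ‖²` for both signs of `r`, a certain differentiable
function of `r` has a minimum at `r = 0`, and its vanishing derivative is the identity. It is proved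
for any flux `G`, so that it also applies to the difference of two solutions and, with monotonicity
of `a ↦ ‖a‖ ^ (p - 2) • a`, gives the `L²` contraction.

Differentiability at every time rests on homogeneity. The function `l ^ (1 / (p - 2)) • u (l * t)`
is again an evolution of the same kind; contraction between two rescalings makes `u` locally
Lipschitz in time into `L²` (`WeakEvolution.exists_lipschitz`). Convexity of `‖·‖ ^ p` bounds energy
drops by the dissipation at another time up to a product of two small `L²` differences
(`WeakEvolution.energy_drop_le`), so `D` agrees a.e. with a Lipschitz function `F`. Hence `E' = -F`
everywhere, and the Poincaré bound passes to every time by continuity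
(`WeakEvolution.exists_hasDerivAt_energy`). The decay is then the scalar lemma
`le_of_hasDerivAt_rpow`. -/

open scoped ENNReal

/-! ### Hölder pairing of vector fields with conjugate exponents. -/

section Pairing

variable {α V : Type*} [MeasurableSpace α] {μ : Measure α}
  [NormedAddCommGroup V] [InnerProductSpace ℝ V] {P Q : ℝ≥0∞}

theorem integrable_inner_of_memLp [ENNReal.HolderConjugate Q P] {f g : α → V}
    (hf : MemLp f Q μ) (hg : MemLp g P μ) :
    Integrable (fun x => inner ℝ (f x) (g x)) μ :=
  memLp_one_iff_integrable.1 (hf.of_bilin (r := 1) (fun a b : V => inner ℝ a b) 1 hg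
    (hf.1.inner hg.1) (.of_forall fun x => by
      simpa using nnnorm_inner_le_nnnorm (𝕜 := ℝ) (f x) (g x)))

theorem tendsto_integral_inner_of_tendsto_eLpNorm [ENNReal.HolderConjugate Q P] {f g : α → V}
    {gk : ℕ → α → V} (hf : MemLp f Q μ) (hg : MemLp g P μ) (hgk : ∀ k, MemLp (gk k) P μ)
    (h : Tendsto (fun k => eLpNorm (fun x => g x - gk k x) P μ) atTop (𝓝 0)) :
    Tendsto (fun k => ∫ x, inner ℝ (f x) (gk k x) ∂μ) atTop (𝓝 (∫ x, inner ℝ (f x) (g x) ∂μ)) := by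
  refine tendsto_integral_of_L1' _ (integrable_inner_of_memLp hf hg).1
    (.of_forall fun k => integrable_inner_of_memLp hf (hgk k)) ?_
  have h' : Tendsto (fun k => eLpNorm f Q μ * eLpNorm (fun x => g x - gk k x) P μ) atTop (𝓝 0) := by
    simpa using ENNReal.Tendsto.const_mul h (.inr hf.2.ne)
  refine tendsto_of_tendsto_of_tendsto_of_le_of_le tendsto_const_nhds h' (fun _ => zero_le) ?_
  intro k
  have h1 : ∀ᵐ x ∂μ, ‖(inner ℝ (f x) (g x - gk k x) : ℝ)‖₊ ≤ 1 * ‖f x‖₊ * ‖g x - gk k x‖₊ :=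
    .of_forall fun x => by
      rw [one_mul]
      exact nnnorm_inner_le_nnnorm (𝕜 := ℝ) _ _
  have h2 := eLpNorm_le_eLpNorm_mul_eLpNorm_of_nnnorm (p := Q) (q := P) (r := 1)
    (g := fun x => g x - gk k x) hf.1 (hg.sub (hgk k)).1
    (fun a b : V => (inner ℝ a b : ℝ)) 1 h1
  rw [ENNReal.coe_one, one_mul] at h2
  refine le_trans (le_of_eq ?_) h2
  rw [← eLpNorm_neg]
  refine congrArg (fun F : α → ℝ => eLpNorm F 1 μ) (funext fun x => ?_)
  simp [inner_sub_right]

end Pairing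

/-! ### Pairings with time translates. -/

section Translation

variable {E V : Type*} [TopologicalSpace E] [MeasurableSpace E] [BorelSpace E] [PolishSpace E]
  [NormedAddCommGroup V] [InnerProductSpace ℝ V] {P Q : ℝ≥0∞} {ν : Measure E}
  [IsLocallyFiniteMeasure ν]

omit [TopologicalSpace E] [BorelSpace E] [PolishSpace E] [IsLocallyFiniteMeasure ν] in
theorem measurePreserving_add_fst [SFinite ν] (r : ℝ) :
    MeasurePreserving (fun z : ℝ × E => (z.1 + r, z.2)) (volume.prod ν) (volume.prod ν) :=
  (measurePreserving_add_right volume r).prod (MeasurePreserving.id ν)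

/-- Translation acts continuously on `L^Q` when `Q` is finite, and pairing with a fixed `g` is a
continuous functional. -/
theorem continuous_integral_inner_translate [SigmaFinite ν] [ENNReal.HolderConjugate Q P]
    (hQ : Q ≠ ∞) {f g : ℝ × E → V}
    (hf : MemLp f Q (volume.prod ν)) (hg : MemLp g P (volume.prod ν)) :
    Continuous fun r : ℝ => ∫ z, inner ℝ (f (z.1 + r, z.2)) (g z) ∂(volume.prod ν) := by
  have : Fact (1 ≤ Q) := ⟨ENNReal.HolderConjugate.one_le Q P⟩
  have : Fact (1 ≤ P) := ⟨ENNReal.HolderConjugate.one_le P Q⟩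
  have : Fact (Q ≠ ∞) := ⟨hQ⟩
  let T : ℝ → C(ℝ × E, ℝ × E) := fun r => ⟨fun z => (z.1 + r, z.2), by fun_prop⟩
  have hT : Continuous T := by
    refine ContinuousMap.continuous_of_continuous_uncurry _ ?_
    simp only [T, Function.uncurry_def, ContinuousMap.coe_mk]
    fun_prop
  have h := (continuous_const (y := hf.toLp f)).compMeasurePreservingLp hT
    (fun r => measurePreserving_add_fst (ν := ν) r) hQ
  let B : V →L[ℝ] V →L[ℝ] ℝ := innerSL ℝ
  have h2 := (B.lpPairing (volume.prod ν) Q P).flip (hg.toLp g) |>.continuous.comp h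
  refine h2.congr fun r => ?_
  have h1 := B.lpPairing_eq_integral (μ := volume.prod ν) (p := Q) (q := P)
    (Lp.compMeasurePreserving (T r) (measurePreserving_add_fst r) (hf.toLp f)) (hg.toLp g)
  refine Eq.trans h1 ?_
  symm
  refine integral_congr_ae ?_
  have h3 := Lp.coeFn_compMeasurePreserving (hf.toLp f) (measurePreserving_add_fst (ν := ν) r)
  have h4 := (measurePreserving_add_fst (ν := ν) r).quasiMeasurePreserving.ae_eq_comp hf.coeFn_toLp
  filter_upwards [h3, h4, hg.coeFn_toLp] with z h3 h4 h5
  simp only [Function.comp] at h3 h4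
  rw [h5]
  refine congrArg (fun a => inner ℝ a (g z)) ?_
  exact h4.symm.trans h3.symm

omit [TopologicalSpace E] [BorelSpace E] [PolishSpace E] [IsLocallyFiniteMeasure ν] in
-- Translation preserves the `L^Q` norm, so Hölder bounds the inner integral uniformly in the shift,
-- and the shifts carry finite measure.
theorem integrable_inner_translate [SigmaFinite ν] [ENNReal.HolderConjugate Q P]
    {f g : ℝ × E → V} (hfm : StronglyMeasurable f) (hgm : StronglyMeasurable g)
    (hf : MemLp f Q (volume.prod ν)) (hg : MemLp g P (volume.prod ν)) (μ : Measure ℝ)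
    [IsFiniteMeasure μ] :
    Integrable (fun y : ℝ × (ℝ × E) => (inner ℝ (f (y.2.1 + y.1, y.2.2)) (g y.2) : ℝ))
      (μ.prod (volume.prod ν)) := by
  have hfr : ∀ r : ℝ, MemLp (fun z : ℝ × E => f (z.1 + r, z.2)) Q (volume.prod ν) := fun r =>
    hf.comp_measurePreserving (measurePreserving_add_fst r)
  have hmeas : StronglyMeasurable
      (fun y : ℝ × (ℝ × E) => (inner ℝ (f (y.2.1 + y.1, y.2.2)) (g y.2) : ℝ)) :=
    (hfm.comp_measurable (by fun_prop)).inner (hgm.comp_measurable measurable_snd)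
  rw [integrable_prod_iff hmeas.aestronglyMeasurable]
  refine ⟨.of_forall fun r => integrable_inner_of_memLp (hfr r) hg, ?_⟩
  refine Integrable.of_bound (C := (eLpNorm f Q (volume.prod ν) *
    eLpNorm g P (volume.prod ν)).toReal) ?_ (.of_forall fun r => ?_)
  · exact hmeas.norm.integral_prod_right.aestronglyMeasurable
  · rw [Real.norm_of_nonneg (integral_nonneg fun _ => norm_nonneg _)]
    rw [integral_norm_eq_lintegral_enorm (integrable_inner_of_memLp (hfr r) hg).1,
      ← eLpNorm_one_eq_lintegral_enorm]
    refine ENNReal.toReal_mono (ENNReal.mul_ne_top hf.2.ne hg.2.ne) ?_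
    have := eLpNorm_le_eLpNorm_mul_eLpNorm_of_nnnorm (p := Q) (q := P) (r := 1) (hfr r).1 hg.1
      (fun a b : V => inner ℝ a b) 1 (.of_forall fun x => by
        simpa using nnnorm_inner_le_nnnorm (𝕜 := ℝ) (f (x.1 + r, x.2)) (g x))
    rw [ENNReal.coe_one, one_mul] at this
    refine this.trans_eq ?_
    congr 1
    exact eLpNorm_comp_measurePreserving hf.1 (measurePreserving_add_fst r)

omit [TopologicalSpace E] [BorelSpace E] [PolishSpace E] [IsLocallyFiniteMeasure ν] in
theorem intervalIntegral_integral_inner_translate [SigmaFinite ν] [ENNReal.HolderConjugate Q P]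
    {f g : ℝ × E → V} (hfm : StronglyMeasurable f) (hgm : StronglyMeasurable g)
    (hf : MemLp f Q (volume.prod ν)) (hg : MemLp g P (volume.prod ν)) (h : ℝ) :
    Integrable (fun τ => ∫ r in 0..h, ∫ x, inner ℝ (f (τ + r, x)) (g (τ, x)) ∂ν) ∧
    ∫ τ, ∫ r in 0..h, ∫ x, inner ℝ (f (τ + r, x)) (g (τ, x)) ∂ν =
      ∫ r in 0..h, ∫ z, inner ℝ (f (z.1 + r, z.2)) (g z) ∂(volume.prod ν) := by
  have : IsFiniteMeasure (volume.restrict (uIoc 0 h)) :=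
    ⟨by simp [uIoc]⟩
  have h1 := integrable_inner_translate hfm hgm hf hg (volume.restrict (uIoc 0 h))
  have h2 := (((measurePreserving_prodAssoc (volume.restrict (uIoc 0 h)) volume ν).integrable_comp
    h1.1).2 h1).integral_prod_left
  simp only [Function.comp_def, MeasurableEquiv.prodAssoc, MeasurableEquiv.coe_mk,
    Equiv.prodAssoc_apply] at h2
  simp only [intervalIntegral.intervalIntegral_eq_integral_uIoc]
  refine ⟨h2.integral_prod_right.smul (if 0 ≤ h then (1 : ℝ) else -1), ?_⟩
  rw [integral_smul]
  congr 1
  rw [← integral_integral_swap (f := fun r τ => ∫ x, inner ℝ (f (τ + r, x)) (g (τ, x)) ∂ν) h2]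
  refine integral_congr_ae ?_
  filter_upwards [h1.prod_right_ae] with r hr
  exact (integral_prod _ hr).symm

end Translation

/-! ### Test functions and linear operations in the Sobolev space. -/

section Sobolev

variable {n : ℕ} {Ω : Opens (EuclideanSpace ℝ (Fin n))} {p : ℝ}

theorem continuous_gradient_testFunction (v : 𝓓(Ω, ℝ)) : Continuous (gradient v) :=
  (InnerProductSpace.toDual ℝ _).symm.continuous.comp
    (v.contDiff.continuous_fderiv (by simp))

theorem hasCompactSupport_gradient_testFunction (v : 𝓓(Ω, ℝ)) : HasCompactSupport (gradient v) :=
  (v.hasCompactSupport.fderiv ℝ).comp_left (g := (InnerProductSpace.toDual ℝ _).symm) (map_zero _)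

theorem memLp_testFunction (v : 𝓓(Ω, ℝ)) (q : ℝ≥0∞) (μ : Measure (EuclideanSpace ℝ (Fin n)))
    [IsFiniteMeasureOnCompacts μ] : MemLp v q μ :=
  v.continuous.memLp_of_hasCompactSupport v.hasCompactSupport

theorem memLp_gradient_testFunction (v : 𝓓(Ω, ℝ)) (q : ℝ≥0∞)
    (μ : Measure (EuclideanSpace ℝ (Fin n))) [IsFiniteMeasureOnCompacts μ] :
    MemLp (gradient v) q μ :=
  (continuous_gradient_testFunction v).memLp_of_hasCompactSupport
    (hasCompactSupport_gradient_testFunction v)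

theorem gradient_testFunction_sub (v w : 𝓓(Ω, ℝ)) (x : EuclideanSpace ℝ (Fin n)) :
    gradient (v - w) x = gradient v x - gradient w x := by
  have h1 : DifferentiableAt ℝ v x := v.contDiff.differentiable (by simp) x
  have h2 : DifferentiableAt ℝ w x := w.contDiff.differentiable (by simp) x
  simp only [gradient]
  rw [← map_sub, ← fderiv_sub h1 h2]
  rfl

theorem gradient_testFunction_smul (c : ℝ) (v : 𝓓(Ω, ℝ)) (x : EuclideanSpace ℝ (Fin n)) :
    gradient (c • v) x = c • gradient v x := by
  have h1 : DifferentiableAt ℝ v x := v.contDiff.differentiable (by simp) x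
  simp only [gradient]
  rw [← map_smul, ← fderiv_const_smul h1]
  rfl

namespace HasSobolevZeroGradient

variable {f f' : EuclideanSpace ℝ (Fin n) → ℝ}
  {g g' : EuclideanSpace ℝ (Fin n) → EuclideanSpace ℝ (Fin n)}

theorem congr (h : HasSobolevZeroGradient Ω p f g)
    (hf : f =ᵐ[volume.restrict (Ω : Set (EuclideanSpace ℝ (Fin n)))] f')
    (hg : g =ᵐ[volume.restrict (Ω : Set (EuclideanSpace ℝ (Fin n)))] g') :
    HasSobolevZeroGradient Ω p f' g' := by
  obtain ⟨φ, h1, h2⟩ := h.exists_approx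
  refine ⟨h.memLp.ae_eq hf, h.memLp_gradient.ae_eq hg, φ, h1.congr fun k => ?_,
    h2.congr fun k => ?_⟩
  · refine eLpNorm_congr_ae ?_
    filter_upwards [hf] with x hx using by rw [hx]
  · refine eLpNorm_congr_ae ?_
    filter_upwards [hg] with x hx using by rw [hx]

theorem sub (hp : 1 ≤ p) (h : HasSobolevZeroGradient Ω p f g)
    (h' : HasSobolevZeroGradient Ω p f' g') :
    HasSobolevZeroGradient Ω p (fun x => f x - f' x) (fun x => g x - g' x) := by
  have hP : 1 ≤ ENNReal.ofReal p := by simpa using ENNReal.ofReal_le_ofReal hp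
  obtain ⟨φ, h1, h2⟩ := h.exists_approx
  obtain ⟨φ', h1', h2'⟩ := h'.exists_approx
  refine ⟨h.memLp.sub h'.memLp, h.memLp_gradient.sub h'.memLp_gradient, fun k => φ k - φ' k,
    ?_, ?_⟩
  · refine tendsto_of_tendsto_of_tendsto_of_le_of_le tendsto_const_nhds
      (by simpa using h1.add h1') (fun _ => zero_le) fun k => ?_
    have := eLpNorm_sub_le (h.memLp.sub (memLp_testFunction (φ k) _ _)).1
      (h'.memLp.sub (memLp_testFunction (φ' k) _ _)).1 hP
    refine le_trans (le_of_eq ?_) this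
    refine congrArg (fun F : EuclideanSpace ℝ (Fin n) → ℝ => eLpNorm F _ _) (funext fun x => ?_)
    change f x - f' x - (φ k x - φ' k x) = f x - φ k x - (f' x - φ' k x)
    abel
  · refine tendsto_of_tendsto_of_tendsto_of_le_of_le tendsto_const_nhds
      (by simpa using h2.add h2') (fun _ => zero_le) fun k => ?_
    have := eLpNorm_sub_le (h.memLp_gradient.sub (memLp_gradient_testFunction (φ k) _ _)).1
      (h'.memLp_gradient.sub (memLp_gradient_testFunction (φ' k) _ _)).1 hP
    refine le_trans (le_of_eq ?_) this
    refine congrArg (fun F : EuclideanSpace ℝ (Fin n) → EuclideanSpace ℝ (Fin n) =>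
      eLpNorm F _ _) (funext fun x => ?_)
    rw [gradient_testFunction_sub]
    change g x - g' x - (gradient (φ k) x - gradient (φ' k) x)
      = g x - gradient (φ k) x - (g' x - gradient (φ' k) x)
    abel

theorem const_smul (h : HasSobolevZeroGradient Ω p f g) (c : ℝ) :
    HasSobolevZeroGradient Ω p (fun x => c * f x) (fun x => c • g x) := by
  obtain ⟨φ, h1, h2⟩ := h.exists_approx
  refine ⟨h.memLp.const_mul c, h.memLp_gradient.const_smul c, fun k => c • φ k, ?_, ?_⟩
  · have := ENNReal.Tendsto.const_mul (a := ‖c‖ₑ) h1 (.inr (by simp))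
    rw [mul_zero] at this
    refine this.congr fun k => ?_
    rw [← eLpNorm_const_smul]
    refine congrArg (fun F : EuclideanSpace ℝ (Fin n) → ℝ => eLpNorm F _ _) (funext fun x => ?_)
    change c * (f x - φ k x) = c * f x - c * φ k x
    ring
  · have := ENNReal.Tendsto.const_mul (a := ‖c‖ₑ) h2 (.inr (by simp))
    rw [mul_zero] at this
    refine this.congr fun k => ?_
    rw [← eLpNorm_const_smul]
    refine congrArg (fun F : EuclideanSpace ℝ (Fin n) → EuclideanSpace ℝ (Fin n) =>
      eLpNorm F _ _) (funext fun x => ?_)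
    rw [gradient_testFunction_smul]
    simp [smul_sub]

end HasSobolevZeroGradient

end Sobolev

/-! ### The flux of the `p`-Laplacian and its conjugate exponent. -/

section Exponents

variable {p : ℝ}

theorem holderConjugate_ofReal (hp : 2 < p) :
    ENNReal.HolderConjugate (ENNReal.ofReal (p / (p - 1))) (ENNReal.ofReal p) :=
  (Real.HolderConjugate.conjExponent (by linarith : 1 < p)).symm.ennrealOfReal

theorem norm_rpow_smul_self {V : Type*} [NormedAddCommGroup V] [NormedSpace ℝ V] (hp : 2 < p)
    (a : V) : ‖‖a‖ ^ (p - 2) • a‖ = ‖a‖ ^ (p - 1) := by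
  rcases eq_or_ne a 0 with rfl | ha
  · simp [Real.zero_rpow (by linarith : p - 1 ≠ 0)]
  · rw [norm_smul, Real.norm_of_nonneg (by positivity)]
    conv_lhs => rw [← Real.rpow_one ‖a‖, ← Real.rpow_mul (norm_nonneg a), one_mul]
    rw [← Real.rpow_add (norm_pos_iff.2 ha)]
    congr 1
    ring

theorem memLp_norm_rpow_smul_self {α V : Type*} [MeasurableSpace α] {μ : Measure α}
    [NormedAddCommGroup V] [NormedSpace ℝ V] (hp : 2 < p) {f : α → V}
    (hf : MemLp f (ENNReal.ofReal p) μ) :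
    MemLp (fun x => ‖f x‖ ^ (p - 2) • f x) (ENNReal.ofReal (p / (p - 1))) μ := by
  have h := hf.norm_rpow_div (ENNReal.ofReal (p - 1))
  rw [← ENNReal.ofReal_div_of_pos (by linarith), ENNReal.toReal_ofReal (by linarith)] at h
  refine h.mono ((hf.1.norm.aemeasurable.pow_const _).aestronglyMeasurable.smul hf.1) ?_
  refine .of_forall fun x => ?_
  rw [norm_rpow_smul_self hp, Real.norm_of_nonneg (by positivity)]

end Exponents

/-! ### Evolutions with a general flux. -/

/-- `(w, γ, G)` solves `w_t = div G` weakly in `Ω × (0, ∞)` with `γ = ∇w ∈ Lᵖ_loc`, `w = 0` on the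
lateral boundary and `G ∈ L^{p'}_loc`. -/
structure WeakEvolution {n : ℕ} (Ω : Opens (EuclideanSpace ℝ (Fin n))) (p : ℝ)
    (w : ℝ → L2Space Ω)
    (γ G : ℝ → EuclideanSpace ℝ (Fin n) → EuclideanSpace ℝ (Fin n)) : Prop where
  continuousOn : ContinuousOn w (Ici 0)
  stronglyMeasurable_gradient : StronglyMeasurable (Function.uncurry γ)
  stronglyMeasurable_flux : StronglyMeasurable (Function.uncurry G)
  memLp_gradient : ∀ T : ℝ, 0 < T → MemLp (Function.uncurry γ) (ENNReal.ofReal p)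
    ((volume.restrict (Ioo 0 T)).prod
      (volume.restrict (Ω : Set (EuclideanSpace ℝ (Fin n)))))
  memLp_flux : ∀ T : ℝ, 0 < T → MemLp (Function.uncurry G) (ENNReal.ofReal (p / (p - 1)))
    ((volume.restrict (Ioo 0 T)).prod
      (volume.restrict (Ω : Set (EuclideanSpace ℝ (Fin n)))))
  hasSobolevZeroGradient :
    ∀ᵐ t ∂(volume.restrict (Ioi (0 : ℝ))), HasSobolevZeroGradient Ω p (w t) (γ t)
  weak : ∀ v : 𝓓(Ω, ℝ), ∀ s t : ℝ, 0 ≤ s → s ≤ t →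
    (∫ x in (Ω : Set (EuclideanSpace ℝ (Fin n))), w t x * v x)
      - (∫ x in (Ω : Set (EuclideanSpace ℝ (Fin n))), w s x * v x)
      + ∫ τ in s..t, ∫ x in (Ω : Set (EuclideanSpace ℝ (Fin n))),
          inner ℝ (G τ x) (gradient v x) = 0

section

variable {n : ℕ} {Ω : Opens (EuclideanSpace ℝ (Fin n))} {p : ℝ}

/-- The given gradient is only a.e. strongly measurable on each time slab. One strongly measurable
version on all of `(0, ∞) × Ω` agrees with it on almost every time slice, which preserves every
condition and makes Fubini available for translates. -/
theorem IsParabolicPLaplaceSolution.exists_weakEvolution (hp : 2 < p) {u₀ : L2Space Ω}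
    {u : ℝ → L2Space Ω} (hu : IsParabolicPLaplaceSolution Ω p u₀ u) :
    ∃ g : ℝ → EuclideanSpace ℝ (Fin n) → EuclideanSpace ℝ (Fin n),
      WeakEvolution Ω p u g fun t x => ‖g t x‖ ^ (p - 2) • g t x := by
  obtain ⟨g, hg, hS, hw⟩ := hu.exists_gradient
  have hm : AEStronglyMeasurable (Function.uncurry g) ((volume.restrict (Ioi 0)).prod
      (volume.restrict (Ω : Set (EuclideanSpace ℝ (Fin n))))) := by
    have hU : Ioi (0 : ℝ) ×ˢ (Ω : Set (EuclideanSpace ℝ (Fin n))) =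
        ⋃ k : ℕ, Ioo (0 : ℝ) (k + 1) ×ˢ (Ω : Set (EuclideanSpace ℝ (Fin n))) := by
      ext ⟨t, x⟩
      simp only [mem_prod, mem_Ioi, mem_iUnion, mem_Ioo]
      constructor
      · rintro ⟨h1, h2⟩
        obtain ⟨k, hk⟩ := exists_nat_gt t
        exact ⟨k, ⟨h1, by linarith⟩, h2⟩
      · rintro ⟨k, ⟨h1, -⟩, h2⟩
        exact ⟨h1, h2⟩
    rw [Measure.prod_restrict, hU, aestronglyMeasurable_iUnion_iff]
    intro k
    rw [← Measure.prod_restrict]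
    exact (hg (k + 1) (by positivity)).1
  set g' : ℝ → EuclideanSpace ℝ (Fin n) → EuclideanSpace ℝ (Fin n) := Function.curry (hm.mk _)
    with hg'
  have hg'm : StronglyMeasurable (Function.uncurry g') := by
    rw [hg', Function.uncurry_curry]; exact hm.stronglyMeasurable_mk
  have hae : Function.uncurry g =ᵐ[(volume.restrict (Ioi 0)).prod
      (volume.restrict (Ω : Set (EuclideanSpace ℝ (Fin n))))] Function.uncurry g' := by
    rw [hg', Function.uncurry_curry]; exact hm.ae_eq_mk
  have hae' : ∀ᵐ t ∂(volume.restrict (Ioi (0 : ℝ))),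
      g t =ᵐ[volume.restrict (Ω : Set (EuclideanSpace ℝ (Fin n)))] g' t :=
    Measure.ae_ae_of_ae_prod hae
  have hL : ∀ T : ℝ, 0 < T → MemLp (Function.uncurry g') (ENNReal.ofReal p)
      ((volume.restrict (Ioo 0 T)).prod
        (volume.restrict (Ω : Set (EuclideanSpace ℝ (Fin n))))) := by
    intro T hT
    refine (hg T hT).ae_eq ?_
    rw [Measure.prod_restrict] at hae ⊢
    exact ae_restrict_of_ae_restrict_of_subset
      (prod_mono_left (fun t ht => ht.1)) hae
  refine ⟨g', hu.continuousOn, hg'm, ?_, hL, fun T hT => ?_, ?_, fun v s t hs hst => ?_⟩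
  · exact (hg'm.norm.measurable.pow_const _).stronglyMeasurable.smul hg'm
  · exact memLp_norm_rpow_smul_self hp (hL T hT)
  · filter_upwards [hS, hae'] with t h1 h2 using h1.congr .rfl h2
  · rw [← hw v s t hs hst]
    congr 1
    refine intervalIntegral.integral_congr_ae ?_
    rw [uIoc_of_le hst]
    have h := (ae_restrict_iff' measurableSet_Ioi).1 hae'
    filter_upwards [h] with τ hτ hmem
    refine integral_congr_ae ?_
    filter_upwards [hτ (hs.trans_lt hmem.1)] with x hx
    rw [hx, real_inner_smul_left]

end

theorem MeasureTheory.MemLp.comp_snd_prod {α β V : Type*} [MeasurableSpace α] [MeasurableSpace β]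
    [NormedAddCommGroup V] {μ : Measure α} [IsFiniteMeasure μ] {ν : Measure β} [SFinite ν]
    {f : β → V} {q : ℝ≥0∞} (hf : MemLp f q ν) :
    MemLp (fun z : α × β => f z.2) q (μ.prod ν) := by
  have h : MemLp f q ((μ.prod ν).map Prod.snd) := by
    rw [Measure.map_snd_prod]
    exact hf.smul_measure (measure_ne_top _ _)
  exact h.comp_of_map measurable_snd.aemeasurable

namespace WeakEvolution

variable {n : ℕ} {Ω : Opens (EuclideanSpace ℝ (Fin n))} {p : ℝ} {w w' : ℝ → L2Space Ω}
  {γ G γ' G' : ℝ → EuclideanSpace ℝ (Fin n) → EuclideanSpace ℝ (Fin n)}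

theorem memLp_flux_Ioc (h : WeakEvolution Ω p w γ G) {s : ℝ} (hs : 0 ≤ s) (t : ℝ) :
    MemLp (Function.uncurry G) (ENNReal.ofReal (p / (p - 1)))
      ((volume.restrict (Ioc s t)).prod
        (volume.restrict (Ω : Set (EuclideanSpace ℝ (Fin n))))) := by
  refine (h.memLp_flux (|t| + 1) (by positivity)).mono_measure ?_
  rw [Measure.prod_restrict, Measure.prod_restrict]
  refine Measure.restrict_mono (prod_mono_left fun τ hτ => ?_) le_rfl
  exact ⟨hs.trans_lt hτ.1, hτ.2.trans_lt (by linarith [le_abs_self t])⟩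

theorem memLp_gradient_Ioc (h : WeakEvolution Ω p w γ G) {s : ℝ} (hs : 0 ≤ s) (t : ℝ) :
    MemLp (Function.uncurry γ) (ENNReal.ofReal p)
      ((volume.restrict (Ioc s t)).prod
        (volume.restrict (Ω : Set (EuclideanSpace ℝ (Fin n))))) := by
  refine (h.memLp_gradient (|t| + 1) (by positivity)).mono_measure ?_
  rw [Measure.prod_restrict, Measure.prod_restrict]
  refine Measure.restrict_mono (prod_mono_left fun τ hτ => ?_) le_rfl
  exact ⟨hs.trans_lt hτ.1, hτ.2.trans_lt (by linarith [le_abs_self t])⟩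

theorem integrable_flux_inner (hp : 2 < p) (h : WeakEvolution Ω p w γ G) {s : ℝ} (hs : 0 ≤ s)
    (t : ℝ) {f : EuclideanSpace ℝ (Fin n) → EuclideanSpace ℝ (Fin n)}
    (hf : MemLp f (ENNReal.ofReal p) (volume.restrict (Ω : Set (EuclideanSpace ℝ (Fin n))))) :
    Integrable (fun z : ℝ × EuclideanSpace ℝ (Fin n) => (inner ℝ (G z.1 z.2) (f z.2) : ℝ))
      ((volume.restrict (Ioc s t)).prod
        (volume.restrict (Ω : Set (EuclideanSpace ℝ (Fin n))))) := by
  have := holderConjugate_ofReal hp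
  exact integrable_inner_of_memLp (h.memLp_flux_Ioc hs t) hf.comp_snd_prod

theorem intervalIntegrable_flux_inner (hp : 2 < p) (h : WeakEvolution Ω p w γ G) {s t : ℝ}
    (hs : 0 ≤ s) (hst : s ≤ t) {f : EuclideanSpace ℝ (Fin n) → EuclideanSpace ℝ (Fin n)}
    (hf : MemLp f (ENNReal.ofReal p) (volume.restrict (Ω : Set (EuclideanSpace ℝ (Fin n))))) :
    IntervalIntegrable (fun τ => ∫ x in (Ω : Set (EuclideanSpace ℝ (Fin n))),
      (inner ℝ (G τ x) (f x) : ℝ)) volume s t := by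
  rw [intervalIntegrable_iff_integrableOn_Ioc_of_le hst]
  exact (h.integrable_flux_inner hp hs t hf).integral_prod_left

theorem ae_memLp_flux (hp : 2 < p) (h : WeakEvolution Ω p w γ G) :
    ∀ᵐ τ ∂(volume.restrict (Ioi (0 : ℝ))), MemLp (G τ) (ENNReal.ofReal (p / (p - 1)))
      (volume.restrict (Ω : Set (EuclideanSpace ℝ (Fin n)))) := by
  have hq : 0 < p / (p - 1) := div_pos (by linarith) (by linarith)
  have hU : Ioi (0 : ℝ) = ⋃ k : ℕ, Ioc (0 : ℝ) (k : ℝ) := by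
    ext t
    simp only [mem_Ioi, mem_iUnion, mem_Ioc]
    refine ⟨fun h1 => ?_, fun ⟨k, h1, _⟩ => h1⟩
    obtain ⟨k, hk⟩ := exists_nat_gt t
    exact ⟨k, h1, hk.le⟩
  rw [hU, ae_restrict_iUnion_iff]
  intro k
  have h1 := (h.memLp_flux_Ioc le_rfl (k : ℝ)).integrable_norm_rpow
    (by simpa using hq) ENNReal.ofReal_ne_top
  filter_upwards [h1.prod_right_ae] with τ hτ
  have hm : AEStronglyMeasurable (G τ)
      (volume.restrict (Ω : Set (EuclideanSpace ℝ (Fin n)))) :=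
    (h.stronglyMeasurable_flux.comp_measurable measurable_prodMk_left).aestronglyMeasurable
  exact (integrable_norm_rpow_iff hm (by simpa using hq) ENNReal.ofReal_ne_top).1 hτ

/-- The equation is linear in the triple once the flux is a free unknown; this is what lets
differences of solutions of the nonlinear problem be treated. -/
theorem sub (hp : 2 < p) (h : WeakEvolution Ω p w γ G) (h' : WeakEvolution Ω p w' γ' G') :
    WeakEvolution Ω p (fun t => w t - w' t) (fun t x => γ t x - γ' t x)
      (fun t x => G t x - G' t x) := by
  refine ⟨h.continuousOn.sub h'.continuousOn,
    h.stronglyMeasurable_gradient.sub h'.stronglyMeasurable_gradient,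
    h.stronglyMeasurable_flux.sub h'.stronglyMeasurable_flux,
    fun T hT => (h.memLp_gradient T hT).sub (h'.memLp_gradient T hT),
    fun T hT => (h.memLp_flux T hT).sub (h'.memLp_flux T hT), ?_, fun v s t hs hst => ?_⟩
  · filter_upwards [h.hasSobolevZeroGradient, h'.hasSobolevZeroGradient] with t h1 h2
    refine (h1.sub (by linarith) h2).congr ?_ .rfl
    filter_upwards [Lp.coeFn_sub (w t) (w' t)] with x hx using hx.symm
  · have hv := memLp_gradient_testFunction v (ENNReal.ofReal p)
      (volume.restrict (Ω : Set (EuclideanSpace ℝ (Fin n))))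
    have hI : ∀ a b : L2Space Ω, (∫ x in (Ω : Set (EuclideanSpace ℝ (Fin n))), (a - b) x * v x)
        = (∫ x in (Ω : Set (EuclideanSpace ℝ (Fin n))), a x * v x)
          - ∫ x in (Ω : Set (EuclideanSpace ℝ (Fin n))), b x * v x := by
      intro a b
      have hv2 := memLp_testFunction v 2 (volume.restrict (Ω : Set (EuclideanSpace ℝ (Fin n))))
      refine Eq.trans ?_ (integral_sub ((Lp.memLp a).integrable_mul hv2)
        ((Lp.memLp b).integrable_mul hv2))
      refine integral_congr_ae ?_
      filter_upwards [Lp.coeFn_sub a b] with x hx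
      rw [hx, Pi.sub_apply, sub_mul]
    have hG : (∫ τ in s..t, ∫ x in (Ω : Set (EuclideanSpace ℝ (Fin n))),
          (inner ℝ (G τ x - G' τ x) (gradient v x) : ℝ))
        = (∫ τ in s..t, ∫ x in (Ω : Set (EuclideanSpace ℝ (Fin n))),
          (inner ℝ (G τ x) (gradient v x) : ℝ)) - ∫ τ in s..t,
            ∫ x in (Ω : Set (EuclideanSpace ℝ (Fin n))), (inner ℝ (G' τ x) (gradient v x) : ℝ) := by
      rw [← intervalIntegral.integral_sub (h.intervalIntegrable_flux_inner hp hs hst hv)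
        (h'.intervalIntegrable_flux_inner hp hs hst hv)]
      refine intervalIntegral.integral_congr_ae ?_
      rw [uIoc_of_le hst]
      have := holderConjugate_ofReal hp
      filter_upwards [(ae_restrict_iff' measurableSet_Ioi).1 (h.ae_memLp_flux hp),
        (ae_restrict_iff' measurableSet_Ioi).1 (h'.ae_memLp_flux hp)] with τ h1 h2 hτ
      have hτ0 : τ ∈ Ioi (0 : ℝ) := hs.trans_lt hτ.1
      rw [← integral_sub (integrable_inner_of_memLp (h1 hτ0) hv)
        (integrable_inner_of_memLp (h2 hτ0) hv)]
      simp only [inner_sub_left]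
    rw [hI, hI, hG]
    linarith [h.weak v s t hs hst, h'.weak v s t hs hst]

theorem scale (h : WeakEvolution Ω p w γ G) (c : ℝ) {l : ℝ} (hl : 0 < l) :
    WeakEvolution Ω p (fun t => c • w (l * t)) (fun t x => c • γ (l * t) x)
      (fun t x => (c * l) • G (l * t) x) := by
  have hmul : Measurable fun z : ℝ × EuclideanSpace ℝ (Fin n) => (l * z.1, z.2) := by fun_prop
  have hmap : ∀ S : Set ℝ, (volume.restrict ((l * ·) ⁻¹' S)).map (l * ·)
      = ENNReal.ofReal l⁻¹ • volume.restrict S := by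
    intro S
    refine ((Homeomorph.mulLeft₀ l hl.ne').measurableEmbedding.restrict_map volume S).symm.trans ?_
    rw [show ⇑(Homeomorph.mulLeft₀ l hl.ne') = (l * ·) from rfl, Real.map_volume_mul_left hl.ne', Measure.restrict_smul, abs_of_pos (inv_pos.2 hl)]
  have hpre : ∀ T : ℝ, (l * ·) ⁻¹' Ioo 0 (l * T) = Ioo 0 T := by
    intro T
    ext t
    simp only [mem_preimage, mem_Ioo, mul_pos_iff_of_pos_left hl, mul_lt_mul_iff_right₀ hl]
  have hLp : ∀ (F : ℝ → EuclideanSpace ℝ (Fin n) → EuclideanSpace ℝ (Fin n)) (q : ℝ≥0∞)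
      (T : ℝ), StronglyMeasurable (Function.uncurry F) →
      MemLp (Function.uncurry F) q ((volume.restrict (Ioo 0 (l * T))).prod
        (volume.restrict (Ω : Set (EuclideanSpace ℝ (Fin n))))) →
      MemLp (fun z : ℝ × EuclideanSpace ℝ (Fin n) => F (l * z.1) z.2) q
        ((volume.restrict (Ioo 0 T)).prod
          (volume.restrict (Ω : Set (EuclideanSpace ℝ (Fin n))))) := by
    intro F q T hF hFT
    refine MemLp.comp_of_map (g := Function.uncurry F) 
      (f := fun z : ℝ × EuclideanSpace ℝ (Fin n) => (l * z.1, z.2)) ?_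
      hmul.aemeasurable
    have : ((volume.restrict (Ioo 0 T)).prod (volume.restrict
        (Ω : Set (EuclideanSpace ℝ (Fin n))))).map (fun z : ℝ × EuclideanSpace ℝ (Fin n) => (l * z.1, z.2))
        = ENNReal.ofReal l⁻¹ • ((volume.restrict (Ioo 0 (l * T))).prod
          (volume.restrict (Ω : Set (EuclideanSpace ℝ (Fin n))))) := by
      have h1 := Measure.map_prod_map (volume.restrict (Ioo 0 T))
        (volume.restrict (Ω : Set (EuclideanSpace ℝ (Fin n))))
        (f := (l * ·)) (g := id) (measurable_const_mul l) measurable_id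
      rw [Measure.map_id, ← hpre T, hmap, Measure.prod_smul_left, hpre T] at h1
      exact h1.symm
    rw [this]
    exact hFT.smul_measure ENNReal.ofReal_ne_top
  refine ⟨?_, ?_, ?_, fun T hT => ?_, fun T hT => ?_, ?_, fun v s t hs hst => ?_⟩
  · refine (h.continuousOn.comp (by fun_prop : ContinuousOn (l * ·) (Ici 0)) ?_).const_smul c
    intro t ht
    exact mul_nonneg hl.le ht
  · exact (h.stronglyMeasurable_gradient.comp_measurable hmul).const_smul c
  · exact (h.stronglyMeasurable_flux.comp_measurable hmul).const_smul (c * l)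
  · exact (hLp γ _ T h.stronglyMeasurable_gradient
      (h.memLp_gradient (l * T) (by positivity))).const_smul c
  · exact (hLp G _ T h.stronglyMeasurable_flux
      (h.memLp_flux (l * T) (by positivity))).const_smul (c * l)
  · have hq : Measure.QuasiMeasurePreserving (l * ·) (volume.restrict (Ioi (0 : ℝ)))
        (volume.restrict (Ioi (0 : ℝ))) := by
      refine ⟨measurable_const_mul l, ?_⟩
      have h1 := hmap (Ioi 0)
      have h2 : (l * ·) ⁻¹' Ioi (0 : ℝ) = Ioi 0 := by
        ext t
        simp only [mem_preimage, mem_Ioi, mul_pos_iff_of_pos_left hl]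
      rw [h2] at h1
      rw [h1]
      exact Measure.smul_absolutelyContinuous
    filter_upwards [hq.ae h.hasSobolevZeroGradient] with t ht
    refine (ht.const_smul c).congr ?_ .rfl
    filter_upwards [Lp.coeFn_smul c (w (l * t))] with x hx using hx.symm
  · have hI : ∀ a : L2Space Ω, (∫ x in (Ω : Set (EuclideanSpace ℝ (Fin n))), (c • a) x * v x)
        = c * ∫ x in (Ω : Set (EuclideanSpace ℝ (Fin n))), a x * v x := by
      intro a
      rw [← integral_const_mul]
      refine integral_congr_ae ?_
      filter_upwards [Lp.coeFn_smul c a] with x hx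
      rw [hx, Pi.smul_apply, smul_eq_mul, mul_assoc]
    have hG : (∫ τ in s..t, ∫ x in (Ω : Set (EuclideanSpace ℝ (Fin n))),
          (inner ℝ ((c * l) • G (l * τ) x) (gradient v x) : ℝ))
        = c * ∫ τ in (l * s)..(l * t), ∫ x in (Ω : Set (EuclideanSpace ℝ (Fin n))),
          (inner ℝ (G τ x) (gradient v x) : ℝ) := by
      have := intervalIntegral.smul_integral_comp_mul_left (a := s) (b := t)
        (fun τ => ∫ x in (Ω : Set (EuclideanSpace ℝ (Fin n))),
          (inner ℝ (G τ x) (gradient v x) : ℝ)) l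
      rw [← this, smul_eq_mul, ← mul_assoc, ← intervalIntegral.integral_const_mul]
      simp only [real_inner_smul_left, integral_const_mul]
    rw [hI, hI, hG, ← mul_sub, ← mul_add, h.weak v _ _ (by positivity) (by gcongr), mul_zero]

/-- Density of test functions: on a bounded set convergence in `L^p` implies convergence in `L²`,
which handles the endpoint terms, while gradient convergence in `L^p` pairs with the flux in the
conjugate space. -/
theorem inner_eq (h : WeakEvolution Ω p w γ G)
    (hΩ : Bornology.IsBounded (Ω : Set (EuclideanSpace ℝ (Fin n)))) (hp : 2 < p) {a : L2Space Ω}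
    {f : EuclideanSpace ℝ (Fin n) → EuclideanSpace ℝ (Fin n)}
    (ha : HasSobolevZeroGradient Ω p a f) {s t : ℝ} (hs : 0 ≤ s) (hst : s ≤ t) :
    inner ℝ (w t) a - inner ℝ (w s) a = - ∫ τ in s..t,
      ∫ x in (Ω : Set (EuclideanSpace ℝ (Fin n))), (inner ℝ (G τ x) (f x) : ℝ) := by
  have hfin : IsFiniteMeasure (volume.restrict (Ω : Set (EuclideanSpace ℝ (Fin n)))) :=
    ⟨by simpa using hΩ.measure_lt_top⟩
  have hH := holderConjugate_ofReal hp
  obtain ⟨φ, h1, h2⟩ := ha.exists_approx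
  have h2p : (2 : ℝ≥0∞) ≤ ENNReal.ofReal p := by
    simpa using ENNReal.ofReal_le_ofReal hp.le
  have hL2 : Tendsto (fun k => eLpNorm (fun x => a x - φ k x) 2
      (volume.restrict (Ω : Set (EuclideanSpace ℝ (Fin n))))) atTop (𝓝 0) := by
    have hc := ENNReal.Tendsto.mul_const (b := (volume.restrict
      (Ω : Set (EuclideanSpace ℝ (Fin n)))) univ ^
        (1 / (2 : ℝ≥0∞).toReal - 1 / (ENNReal.ofReal p).toReal)) h1
      (.inr (ENNReal.rpow_ne_top_of_nonneg ?_ (measure_ne_top _ _)))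
    · rw [zero_mul] at hc
      refine tendsto_of_tendsto_of_tendsto_of_le_of_le tendsto_const_nhds hc
        (fun _ => zero_le) fun k => ?_
      exact eLpNorm_le_eLpNorm_mul_rpow_measure_univ h2p
        (ha.memLp.sub (memLp_testFunction (φ k) _ _)).1
    · rw [ENNReal.toReal_ofReal (by linarith), sub_nonneg]
      exact one_div_le_one_div_of_le (by norm_num) (by simpa using hp.le)
  have hT : ∀ b : L2Space Ω, Tendsto
      (fun k => ∫ x in (Ω : Set (EuclideanSpace ℝ (Fin n))), b x * φ k x) atTop
      (𝓝 (inner ℝ b a)) := by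
    intro b
    have := tendsto_integral_inner_of_tendsto_eLpNorm (P := 2) (Q := 2) (Lp.memLp b) (Lp.memLp a)
      (fun k => memLp_testFunction (φ k) _ _) hL2
    rw [L2.inner_def]
    refine this.congr fun k => integral_congr_ae (.of_forall fun x => ?_)
    simp [mul_comm]
  have hG : Tendsto (fun k => ∫ τ in s..t, ∫ x in (Ω : Set (EuclideanSpace ℝ (Fin n))),
      (inner ℝ (G τ x) (gradient (φ k) x) : ℝ)) atTop
      (𝓝 (∫ τ in s..t, ∫ x in (Ω : Set (EuclideanSpace ℝ (Fin n))),
        (inner ℝ (G τ x) (f x) : ℝ))) := by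
    have hgr : ∀ k, MemLp (gradient (φ k)) (ENNReal.ofReal p)
        (volume.restrict (Ω : Set (EuclideanSpace ℝ (Fin n)))) :=
      fun k => memLp_gradient_testFunction _ _ _
    have hl : Tendsto (fun k => eLpNorm
        (fun z : ℝ × EuclideanSpace ℝ (Fin n) => f z.2 - gradient (φ k) z.2) (ENNReal.ofReal p)
        ((volume.restrict (Ioc s t)).prod
          (volume.restrict (Ω : Set (EuclideanSpace ℝ (Fin n)))))) atTop (𝓝 0) := by
      -- A function of `x` alone has its product norm multiplied by the length of the time interval
      -- to the power `1 / p`.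
      have hc := ENNReal.Tendsto.const_mul (a := (volume.restrict (Ioc s t)) univ ^
        (1 / (ENNReal.ofReal p)).toReal) h2
        (.inr (ENNReal.rpow_ne_top_of_nonneg (by positivity) (measure_ne_top _ _)))
      rw [mul_zero] at hc
      refine hc.congr fun k => ?_
      rw [← smul_eq_mul, ← eLpNorm_smul_measure_of_ne_top ENNReal.ofReal_ne_top,
        ← Measure.map_snd_prod]
      refine eLpNorm_map_measure ?_ measurable_snd.aemeasurable
      rw [Measure.map_snd_prod]
      exact ((ha.memLp_gradient.sub (hgr k)).smul_measure (measure_ne_top _ _)).1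
    have := tendsto_integral_inner_of_tendsto_eLpNorm (h.memLp_flux_Ioc hs t)
      ha.memLp_gradient.comp_snd_prod (fun k => (hgr k).comp_snd_prod) hl
    simp only [intervalIntegral.integral_of_le hst]
    have hP : ∀ {f : EuclideanSpace ℝ (Fin n) → EuclideanSpace ℝ (Fin n)},
        MemLp f (ENNReal.ofReal p) (volume.restrict (Ω : Set (EuclideanSpace ℝ (Fin n)))) →
        ∫ z, (inner ℝ (Function.uncurry G z) (f z.2) : ℝ) ∂((volume.restrict (Ioc s t)).prod
          (volume.restrict (Ω : Set (EuclideanSpace ℝ (Fin n))))) =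
        ∫ τ in Ioc s t, ∫ x in (Ω : Set (EuclideanSpace ℝ (Fin n))), (inner ℝ (G τ x) (f x) : ℝ) :=
      fun hf => integral_prod _ (h.integrable_flux_inner hp hs t hf)
    rw [hP ha.memLp_gradient] at this
    exact this.congr fun k => hP (hgr k)
  have hlim := ((hT (w t)).sub (hT (w s))).add hG
  have h0 := tendsto_nhds_unique hlim
    (tendsto_const_nhds.congr fun k => (h.weak (φ k) s t hs hst).symm)
  linarith

end WeakEvolution

/-! ### The energy identity and monotonicity of the norm. -/

namespace WeakEvolution

variable {n : ℕ} {Ω : Opens (EuclideanSpace ℝ (Fin n))} {p : ℝ} {w w' : ℝ → L2Space Ω}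
  {γ G γ' G' : ℝ → EuclideanSpace ℝ (Fin n) → EuclideanSpace ℝ (Fin n)}

theorem inner_eq' (h : WeakEvolution Ω p w γ G)
    (hΩ : Bornology.IsBounded (Ω : Set (EuclideanSpace ℝ (Fin n)))) (hp : 2 < p) {a : L2Space Ω}
    {f : EuclideanSpace ℝ (Fin n) → EuclideanSpace ℝ (Fin n)}
    (ha : HasSobolevZeroGradient Ω p a f) {s t : ℝ} (hs : 0 ≤ s) (ht : 0 ≤ t) :
    inner ℝ (w t) a - inner ℝ (w s) a = - ∫ τ in s..t,
      ∫ x in (Ω : Set (EuclideanSpace ℝ (Fin n))), (inner ℝ (G τ x) (f x) : ℝ) := by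
  rcases le_total s t with hst | hst
  · exact h.inner_eq hΩ hp ha hs hst
  · rw [intervalIntegral.integral_symm, ← h.inner_eq hΩ hp ha ht hst]
    ring

/-- No time derivative of `w` is available, so the identity is read off as a first-order condition:
testing with `w τ` over the times between `τ` and `τ + r` bounds the averaged energy increment from
below, for shifts of either sign, with equality at `r = 0`. -/
theorem energy_identity (h : WeakEvolution Ω p w γ G)
    (hΩ : Bornology.IsBounded (Ω : Set (EuclideanSpace ℝ (Fin n)))) (hp : 2 < p) {s t : ℝ}
    (hs : 0 < s) (hst : s ≤ t) :
    1 / 2 * ‖w t‖ ^ 2 - 1 / 2 * ‖w s‖ ^ 2 = - ∫ τ in s..t,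
      ∫ x in (Ω : Set (EuclideanSpace ℝ (Fin n))), (inner ℝ (G τ x) (γ τ x) : ℝ) := by
  have hH := holderConjugate_ofReal hp
  set ν := volume.restrict (Ω : Set (EuclideanSpace ℝ (Fin n))) with hν
  have hprod : ∀ S : Set ℝ, (volume.restrict S).prod ν
      = ((volume : Measure ℝ).prod ν).restrict (S ×ˢ univ) := by
    intro S
    rw [← Measure.prod_restrict, Measure.restrict_univ]
  have hSm : ∀ {S : Set ℝ}, MeasurableSet S →
      MeasurableSet (S ×ˢ (univ : Set (EuclideanSpace ℝ (Fin n)))) :=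
    fun hS => hS.prod MeasurableSet.univ
  -- The window `(0, t + s)` contains `τ + r` for every `τ ∈ (s, t]` and `|r| < s`, so truncating
  -- the flux to it changes nothing for small shifts.
  set f : ℝ × EuclideanSpace ℝ (Fin n) → EuclideanSpace ℝ (Fin n) :=
    (Ioo 0 (t + s) ×ˢ univ).indicator (Function.uncurry G) with hf
  set g : ℝ × EuclideanSpace ℝ (Fin n) → EuclideanSpace ℝ (Fin n) :=
    (Ioc s t ×ˢ univ).indicator (Function.uncurry γ) with hg
  have hfm : StronglyMeasurable f := h.stronglyMeasurable_flux.indicator (hSm measurableSet_Ioo)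
  have hgm : StronglyMeasurable g :=
    h.stronglyMeasurable_gradient.indicator (hSm measurableSet_Ioc)
  have hfL : MemLp f (ENNReal.ofReal (p / (p - 1))) ((volume : Measure ℝ).prod ν) := by
    rw [hf, memLp_indicator_iff_restrict (hSm measurableSet_Ioo), ← hprod]
    exact h.memLp_flux _ (by linarith)
  have hgL : MemLp g (ENNReal.ofReal p) ((volume : Measure ℝ).prod ν) := by
    rw [hg, memLp_indicator_iff_restrict (hSm measurableSet_Ioc), ← hprod]
    exact h.memLp_gradient_Ioc hs.le t
  have hf_eq : ∀ τ ∈ Ioo 0 (t + s), ∀ x, f (τ, x) = G τ x := fun τ hτ x => by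
    rw [hf, indicator_of_mem (by exact ⟨hτ, mem_univ _⟩)]
    rfl
  have hg_eq : ∀ τ ∈ Ioc s t, ∀ x, g (τ, x) = γ τ x := fun τ hτ x => by
    rw [hg, indicator_of_mem (by exact ⟨hτ, mem_univ _⟩)]
    rfl
  have hg_zero : ∀ τ ∉ Ioc s t, ∀ x, g (τ, x) = 0 := fun τ hτ x => by
    rw [hg, indicator_of_notMem (fun hh => hτ hh.1)]
  set K : ℝ → ℝ := fun r => ∫ z, inner ℝ (f (z.1 + r, z.2)) (g z) ∂((volume : Measure ℝ).prod ν)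
    with hK
  have hKc : Continuous K :=
    continuous_integral_inner_translate ENNReal.ofReal_ne_top hfL hgL
  have hK0 : K 0 = ∫ τ in s..t, ∫ x, (inner ℝ (G τ x) (γ τ x) : ℝ) ∂ν := by
    rw [intervalIntegral.integral_of_le hst]
    have h1 := integrable_inner_of_memLp (h.memLp_flux_Ioc hs.le t) (h.memLp_gradient_Ioc hs.le t)
    refine Eq.trans ?_ (integral_prod _ h1)
    rw [hprod, ← integral_indicator (hSm measurableSet_Ioc), hK]
    refine integral_congr_ae (.of_forall fun z => ?_)
    obtain ⟨τ, x⟩ := z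
    by_cases hτ : τ ∈ Ioc s t
    · rw [indicator_of_mem (by exact ⟨hτ, mem_univ _⟩)]
      simp only [add_zero]
      rw [hg_eq τ hτ, hf_eq τ ⟨hs.trans hτ.1, by linarith [hτ.2]⟩]
      rfl
    · rw [indicator_of_notMem (fun hh => hτ hh.1)]
      simp [hg_zero τ hτ]
  -- Only times `τ ≥ 0` are controlled; freezing the energy at its value at `0` for negative times
  -- gives a function continuous on the whole line.
  set Φ : ℝ → ℝ := fun τ => 1 / 2 * ‖w (max τ 0)‖ ^ 2 with hΦ
  have hΦc : Continuous Φ := by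
    have : Continuous fun τ => w (max τ 0) :=
      h.continuousOn.comp_continuous (by fun_prop) (fun τ => mem_Ici.2 (le_max_right _ _))
    exact continuous_const.mul (this.norm.pow 2)
  have hΦ_eq : ∀ τ, 0 ≤ τ → Φ τ = 1 / 2 * ‖w τ‖ ^ 2 := fun τ hτ => by
    simp only [hΦ, max_eq_left hτ]
  have hP : ∀ y, HasDerivAt (fun y => ∫ τ in (0 : ℝ)..y, Φ τ) (Φ y) y := fun y =>
    intervalIntegral.integral_hasDerivAt_right (hΦc.intervalIntegrable _ _)
      hΦc.stronglyMeasurable.stronglyMeasurableAtFilter hΦc.continuousAt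
  -- Up to an additive constant, `J r` is the integral over `(s, t)` of `Φ (τ + r) - Φ τ` plus the
  -- accumulated flux pairing, and its derivative at `0` is exactly the defect in the energy
  -- identity.
  set J : ℝ → ℝ := fun r => ((∫ τ in (0 : ℝ)..(t + r), Φ τ) - ∫ τ in (0 : ℝ)..(s + r), Φ τ)
    + ∫ y in (0 : ℝ)..r, K y with hJ
  have hJd : HasDerivAt J (Φ t - Φ s + K 0) 0 := by
    have h1 : HasDerivAt (fun r => ∫ τ in (0 : ℝ)..(t + r), Φ τ) (Φ t) 0 := by
      have := HasDerivAt.comp_const_add t 0 (by simpa using hP t)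
      simpa using this
    have h2 : HasDerivAt (fun r => ∫ τ in (0 : ℝ)..(s + r), Φ τ) (Φ s) 0 := by
      have := HasDerivAt.comp_const_add s 0 (by simpa using hP s)
      simpa using this
    exact (h1.sub h2).add (intervalIntegral.integral_hasDerivAt_right
      (hKc.intervalIntegrable _ _) hKc.stronglyMeasurable.stronglyMeasurableAtFilter
      hKc.continuousAt)
  have hmin : IsLocalMin J 0 := by
    filter_upwards [Ioo_mem_nhds (neg_lt_zero.2 hs) hs] with r hr
    obtain ⟨hAi, hA⟩ := intervalIntegral_integral_inner_translate hfm hgm hfL hgL r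
    set A : ℝ → ℝ := fun τ => ∫ y in (0 : ℝ)..r, ∫ x, inner ℝ (f (τ + y, x)) (g (τ, x)) ∂ν
      with hAdef
    have hA0 : ∀ τ ∉ Ioc s t, A τ = 0 := fun τ hτ => by
      simp [hAdef, hg_zero τ hτ]
    have hA' : ∫ y in (0 : ℝ)..r, K y = ∫ τ in s..t, A τ := by
      rw [intervalIntegral.integral_of_le hst, setIntegral_eq_integral_of_forall_compl_eq_zero hA0]
      exact hA.symm
    have hAE : ∀ᵐ τ ∂(volume.restrict (Ioc s t)), -A τ ≤ Φ (τ + r) - Φ τ := by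
      rw [ae_restrict_iff' measurableSet_Ioc]
      filter_upwards [(ae_restrict_iff' measurableSet_Ioi).1 h.hasSobolevZeroGradient] with τ h1 hτ
      have hτ0 : 0 < τ := hs.trans hτ.1
      have hτr : 0 ≤ τ + r := by linarith [hr.1, hτ.1]
      have h2 := h.inner_eq' hΩ hp (h1 hτ0) hτ0.le hτr
      have h3 : A τ = ∫ σ in τ..(τ + r), ∫ x, (inner ℝ (G σ x) (γ τ x) : ℝ) ∂ν := by
        have h4 := intervalIntegral.integral_comp_add_left (a := 0) (b := r)
          (fun σ => ∫ x, (inner ℝ (G σ x) (γ τ x) : ℝ) ∂ν) τ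
        rw [add_zero] at h4
        rw [← h4, hAdef]
        refine intervalIntegral.integral_congr fun y hy => ?_
        have hy' : τ + y ∈ Ioo 0 (t + s) := by
          rcases le_total 0 r with h0 | h0
          · rw [uIcc_of_le h0] at hy
            exact ⟨by linarith [hy.1], by linarith [hy.2, hr.2, hτ.2]⟩
          · rw [uIcc_of_ge h0] at hy
            exact ⟨by linarith [hy.1, hr.1, hτ.1], by linarith [hy.2, hτ.2]⟩
        simp only [hf_eq _ hy', hg_eq τ hτ]
      rw [h3, ← h2, hΦ_eq _ hτr, hΦ_eq _ hτ0.le]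
      -- Nonnegativity of `‖w (τ + r) - w τ‖²` turns the tested equation into a bound for the energy
      -- increment.
      have h5 := norm_sub_sq_real (w (τ + r)) (w τ)
      rw [real_inner_self_eq_norm_sq]
      nlinarith [sq_nonneg ‖w (τ + r) - w τ‖]
    have hΦr : Continuous fun τ => Φ (τ + r) := by fun_prop
    have hint : ∫ τ in s..t, -A τ ≤ ∫ τ in s..t, (Φ (τ + r) - Φ τ) := by
      rw [intervalIntegral.integral_of_le hst, intervalIntegral.integral_of_le hst]
      exact integral_mono_ae hAi.neg.integrableOn
        ((hΦr.sub hΦc).integrableOn_Icc.mono_set Ioc_subset_Icc_self) hAE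
    rw [intervalIntegral.integral_neg, ← hA', intervalIntegral.integral_sub
      (hΦr.intervalIntegrable _ _) (hΦc.intervalIntegrable _ _),
      intervalIntegral.integral_comp_add_right] at hint
    have h6 := intervalIntegral.integral_interval_sub_left
      (hΦc.intervalIntegrable (μ := volume) 0 (t + r)) (hΦc.intervalIntegrable 0 (s + r))
    have h7 := intervalIntegral.integral_interval_sub_left
      (hΦc.intervalIntegrable (μ := volume) 0 t) (hΦc.intervalIntegrable 0 s)
    simp only [hJ, add_zero, intervalIntegral.integral_same]
    linarith
  have h0 := hmin.hasDerivAt_eq_zero hJd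
  rw [← hK0, ← hΦ_eq t (by linarith), ← hΦ_eq s hs.le]
  linarith

/-- If the flux has a nonnegative product with the gradient, then the `L²` norm is nonincreasing. -/
theorem norm_antitoneOn (h : WeakEvolution Ω p w γ G)
    (hΩ : Bornology.IsBounded (Ω : Set (EuclideanSpace ℝ (Fin n)))) (hp : 2 < p)
    (hmono : ∀ t x, 0 ≤ (inner ℝ (G t x) (γ t x) : ℝ)) : AntitoneOn (fun t => ‖w t‖) (Ici 0) := by
  have hpos : ∀ s t, 0 < s → s ≤ t → ‖w t‖ ≤ ‖w s‖ := by
    intro s t hs hst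
    have h1 := h.energy_identity hΩ hp hs hst
    have h2 : 0 ≤ ∫ τ in s..t, ∫ x in (Ω : Set (EuclideanSpace ℝ (Fin n))),
        (inner ℝ (G τ x) (γ τ x) : ℝ) :=
      intervalIntegral.integral_nonneg hst fun τ _ => integral_nonneg fun x => hmono τ x
    exact (sq_le_sq₀ (norm_nonneg _) (norm_nonneg _)).1 (by linarith)
  -- The energy identity requires a positive initial time; time `0` is reached by continuity in
  -- `L²`.
  intro s hs t ht hst
  rcases eq_or_lt_of_le (show (0 : ℝ) ≤ s from hs) with rfl | hs0
  · rcases eq_or_lt_of_le hst with rfl | ht0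
    · exact le_rfl
    have hc : Tendsto (fun r => ‖w r‖) (𝓝[>] 0) (𝓝 ‖w 0‖) :=
      ((h.continuousOn 0 hs).mono_left (nhdsWithin_mono _ Ioi_subset_Ici_self)).norm
    refine ge_of_tendsto hc ?_
    filter_upwards [Ioo_mem_nhdsGT ht0] with r hr using hpos r t hr.1 hr.2.le
  · exact hpos s t hs0 hst

end WeakEvolution

/-! ### Convexity of the `p`-th power and monotonicity of the flux. -/

section Convexity

variable {V : Type*} [NormedAddCommGroup V] [InnerProductSpace ℝ V] {p : ℝ}

theorem inner_norm_rpow_smul_self (hp : 2 < p) (a : V) :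
    (inner ℝ (‖a‖ ^ (p - 2) • a) a : ℝ) = ‖a‖ ^ p := by
  rw [real_inner_smul_left, real_inner_self_eq_norm_sq]
  rcases eq_or_ne a 0 with rfl | ha
  · simp [Real.zero_rpow (by linarith : p ≠ 0)]
  · rw [← Real.rpow_natCast ‖a‖ 2, ← Real.rpow_add (norm_pos_iff.2 ha)]
    congr 1
    push_cast
    ring

/-- This is the tangent inequality for the convex function `‖·‖ ^ p`, obtained from Cauchy–Schwarz
and Young's inequality. -/
theorem norm_rpow_sub_norm_rpow_le (hp : 2 < p) (a b : V) :
    ‖a‖ ^ p - ‖b‖ ^ p ≤ p * inner ℝ (‖a‖ ^ (p - 2) • a) (a - b) := by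
  have hp1 : 0 < p - 1 := by linarith
  have hpq : (p / (p - 1)).HolderConjugate p :=
    (Real.HolderConjugate.conjExponent (by linarith : 1 < p)).symm
  have h1 : (inner ℝ (‖a‖ ^ (p - 2) • a) b : ℝ) ≤ ‖a‖ ^ (p - 1) * ‖b‖ := by
    rw [← norm_rpow_smul_self hp a]
    exact real_inner_le_norm _ _
  have h2 := Real.young_inequality_of_nonneg (a := ‖a‖ ^ (p - 1)) (b := ‖b‖) (by positivity)
    (by positivity) hpq
  rw [← Real.rpow_mul (norm_nonneg a), mul_div_cancel₀ _ hp1.ne'] at h2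
  rw [inner_sub_right, inner_norm_rpow_smul_self hp]
  have h3 : p * (‖a‖ ^ p / (p / (p - 1)) + ‖b‖ ^ p / p) = (p - 1) * ‖a‖ ^ p + ‖b‖ ^ p := by
    field_simp
  have h4 := mul_le_mul_of_nonneg_left (h1.trans h2) (by linarith : 0 ≤ p)
  rw [h3] at h4
  linarith

/-- Add the tangent inequalities at `a` and at `b`; the left-hand sides cancel. -/
theorem inner_norm_rpow_smul_sub_nonneg (hp : 2 < p) (a b : V) :
    0 ≤ (inner ℝ (‖a‖ ^ (p - 2) • a - ‖b‖ ^ (p - 2) • b) (a - b) : ℝ) := by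
  have h1 := norm_rpow_sub_norm_rpow_le hp a b
  have h2 := norm_rpow_sub_norm_rpow_le hp b a
  rw [← neg_sub a b, inner_neg_right] at h2
  rw [inner_sub_left]
  have : 0 ≤ p * ((inner ℝ (‖a‖ ^ (p - 2) • a) (a - b) : ℝ)
      - inner ℝ (‖b‖ ^ (p - 2) • b) (a - b)) := by linarith
  exact nonneg_of_mul_nonneg_right this (by linarith)

end Convexity

/-! ### Contraction, scaling and Lipschitz continuity in time. -/

theorem exists_rpow_lipschitz (α : ℝ) {a b : ℝ} (ha : 0 < a) :
    ∃ M : ℝ, 0 ≤ M ∧ ∀ s ∈ Icc a b, ∀ t ∈ Icc a b, |t ^ α - s ^ α| ≤ M * |t - s| := by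
  have hne : ∀ x ∈ Icc a b, x ≠ 0 := fun x hx => (ha.trans_le hx.1).ne'
  have hc : ContinuousOn (fun x : ℝ => α * x ^ (α - 1)) (Icc a b) :=
    continuousOn_const.mul (continuousOn_id.rpow_const fun x hx => .inl (hne x hx))
  obtain ⟨M, hM⟩ := isCompact_Icc.exists_bound_of_continuousOn hc
  refine ⟨max M 0, le_max_right _ _, fun s hs t ht => ?_⟩
  have := (convex_Icc a b).norm_image_sub_le_of_norm_hasDerivWithin_le (f := fun x : ℝ => x ^ α)
    (fun x hx => (Real.hasDerivAt_rpow_const (.inl (hne x hx))).hasDerivWithinAt)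
    (fun x hx => (hM x hx).trans (le_max_left M 0)) hs ht
  simpa using this

namespace WeakEvolution

variable {n : ℕ} {Ω : Opens (EuclideanSpace ℝ (Fin n))} {p : ℝ} {u u' : ℝ → L2Space Ω}
  {g g' : ℝ → EuclideanSpace ℝ (Fin n) → EuclideanSpace ℝ (Fin n)}

theorem norm_sub_le (h : WeakEvolution Ω p u g fun t x => ‖g t x‖ ^ (p - 2) • g t x)
    (h' : WeakEvolution Ω p u' g' fun t x => ‖g' t x‖ ^ (p - 2) • g' t x)
    (hΩ : Bornology.IsBounded (Ω : Set (EuclideanSpace ℝ (Fin n)))) (hp : 2 < p)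
    {t : ℝ} (ht : 0 ≤ t) : ‖u t - u' t‖ ≤ ‖u 0 - u' 0‖ :=
  (h.sub hp h').norm_antitoneOn hΩ hp (fun _ _ => inner_norm_rpow_smul_sub_nonneg hp _ _)
    self_mem_Ici ht ht

/-- The factor `c = l ^ (1 / (p - 2))` is chosen so that `c ^ (p - 2) = l`: the homogeneous flux
then picks up the same factor `c * l` as the time derivative. -/
theorem rescale (h : WeakEvolution Ω p u g fun t x => ‖g t x‖ ^ (p - 2) • g t x) (hp : 2 < p)
    {l : ℝ} (hl : 0 < l) :
    WeakEvolution Ω p (fun t => l ^ (1 / (p - 2)) • u (l * t))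
      (fun t x => l ^ (1 / (p - 2)) • g (l * t) x)
      fun t x => ‖l ^ (1 / (p - 2)) • g (l * t) x‖ ^ (p - 2) •
        (l ^ (1 / (p - 2)) • g (l * t) x) := by
  convert h.scale (l ^ (1 / (p - 2))) hl using 3 with t x
  have hc : 0 ≤ l ^ (1 / (p - 2)) := by positivity
  rw [norm_smul, Real.norm_of_nonneg hc, Real.mul_rpow hc (norm_nonneg _),
    ← Real.rpow_mul hl.le, one_div_mul_cancel (by linarith), Real.rpow_one, smul_smul, smul_smul]
  congr 1
  ring

theorem norm_le_initial (h : WeakEvolution Ω p u g fun t x => ‖g t x‖ ^ (p - 2) • g t x)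
    (hΩ : Bornology.IsBounded (Ω : Set (EuclideanSpace ℝ (Fin n)))) (hp : 2 < p)
    {t : ℝ} (ht : 0 ≤ t) : ‖u t‖ ≤ ‖u 0‖ := by
  refine h.norm_antitoneOn hΩ hp (fun t x => ?_) self_mem_Ici ht ht
  rw [inner_norm_rpow_smul_self hp]
  positivity

/-- A homogeneity argument: a change of time scale amounts to a change of initial value, and the
contraction controls the latter. -/
theorem exists_lipschitz (h : WeakEvolution Ω p u g fun t x => ‖g t x‖ ^ (p - 2) • g t x)
    (hΩ : Bornology.IsBounded (Ω : Set (EuclideanSpace ℝ (Fin n)))) (hp : 2 < p)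
    {a : ℝ} (ha : 0 < a) (b : ℝ) :
    ∃ L : ℝ, 0 ≤ L ∧ ∀ s ∈ Icc a b, ∀ t ∈ Icc a b, ‖u t - u s‖ ≤ L * |t - s| := by
  set α := 1 / (p - 2) with hα
  have hα0 : 0 ≤ α := one_div_nonneg.2 (by linarith)
  obtain ⟨M, hM0, hM⟩ := exists_rpow_lipschitz α (b := b) ha
  have haα : 0 < a ^ α := by positivity
  refine ⟨2 * M * ‖u 0‖ / a ^ α, by positivity, fun s hs t ht => ?_⟩
  have hs0 : 0 < s := ha.trans_le hs.1
  have ht0 : 0 < t := ha.trans_le ht.1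
  -- At time `1` the rescalings with `l = t` and `l = s` equal `t ^ α • u t` and `s ^ α • u s`; at
  -- time `0` they are multiples of the same `u 0`.
  have h1 := (h.rescale hp ht0).norm_sub_le (h.rescale hp hs0) hΩ hp zero_le_one
  simp only [mul_one, mul_zero, ← sub_smul] at h1
  rw [norm_smul, Real.norm_eq_abs] at h1
  have h2 : t ^ α • (u t - u s) = (t ^ α • u t - s ^ α • u s) - (t ^ α - s ^ α) • u s := by
    module
  have h3 : t ^ α * ‖u t - u s‖ ≤ 2 * M * ‖u 0‖ * |t - s| := by
    calc t ^ α * ‖u t - u s‖ = ‖t ^ α • (u t - u s)‖ := by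
          rw [norm_smul, Real.norm_of_nonneg (by positivity)]
      _ ≤ ‖t ^ α • u t - s ^ α • u s‖ + ‖(t ^ α - s ^ α) • u s‖ := by
          rw [h2]; exact _root_.norm_sub_le _ _
      _ ≤ |t ^ α - s ^ α| * ‖u 0‖ + |t ^ α - s ^ α| * ‖u 0‖ := by
          rw [norm_smul, Real.norm_eq_abs]
          gcongr
          exact h.norm_le_initial hΩ hp hs0.le
      _ ≤ M * |t - s| * ‖u 0‖ + M * |t - s| * ‖u 0‖ := by
          gcongr <;> exact hM s hs t ht
      _ = 2 * M * ‖u 0‖ * |t - s| := by ring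
  have h4 : a ^ α * ‖u t - u s‖ ≤ 2 * M * ‖u 0‖ * |t - s| :=
    (mul_le_mul_of_nonneg_right (Real.rpow_le_rpow ha.le ht.1 hα0) (norm_nonneg _)).trans h3
  rw [div_mul_eq_mul_div, le_div_iff₀ haα]
  linarith

theorem energy_sub_eq (h : WeakEvolution Ω p u g fun t x => ‖g t x‖ ^ (p - 2) • g t x)
    (hΩ : Bornology.IsBounded (Ω : Set (EuclideanSpace ℝ (Fin n)))) (hp : 2 < p) {s t : ℝ}
    (hs : 0 < s) (hst : s ≤ t) :
    l2Energy u t - l2Energy u s = - ∫ τ in s..t,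
      ∫ x in (Ω : Set (EuclideanSpace ℝ (Fin n))), ‖g τ x‖ ^ p := by
  simpa only [l2Energy, inner_norm_rpow_smul_self hp] using h.energy_identity hΩ hp hs hst

theorem intervalIntegrable_dissipation
    (h : WeakEvolution Ω p u g fun t x => ‖g t x‖ ^ (p - 2) • g t x) (hp : 2 < p) {s t : ℝ}
    (hs : 0 ≤ s) (hst : s ≤ t) : IntervalIntegrable
      (fun τ => ∫ x in (Ω : Set (EuclideanSpace ℝ (Fin n))), ‖g τ x‖ ^ p) volume s t := by
  rw [intervalIntegrable_iff_integrableOn_Ioc_of_le hst]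
  have := (h.memLp_gradient_Ioc hs t).integrable_norm_rpow (by simpa using by linarith)
    ENNReal.ofReal_ne_top
  rw [ENNReal.toReal_ofReal (by linarith)] at this
  exact this.integral_prod_left

/-- Convexity of the `p`-Dirichlet integral compares the energy drop with the dissipation at another
time. -/
theorem energy_drop_le (h : WeakEvolution Ω p u g fun t x => ‖g t x‖ ^ (p - 2) • g t x)
    (hΩ : Bornology.IsBounded (Ω : Set (EuclideanSpace ℝ (Fin n)))) (hp : 2 < p) :
    ∀ᵐ s ∂(volume.restrict (Ioi (0 : ℝ))), ∀ a b, 0 < a → a ≤ b →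
      l2Energy u a - l2Energy u b
        ≤ (b - a) * (∫ x in (Ω : Set (EuclideanSpace ℝ (Fin n))), ‖g s x‖ ^ p)
          + p * inner ℝ (u a - u b) ((1 / 2 : ℝ) • (u a + u b) - u s) := by
  have hH := holderConjugate_ofReal hp
  filter_upwards [h.hasSobolevZeroGradient] with s hs a b ha hab
  set ν := volume.restrict (Ω : Set (EuclideanSpace ℝ (Fin n))) with hν
  set D := ∫ x, ‖g s x‖ ^ p ∂ν with hD
  have hpow : ∀ {f : EuclideanSpace ℝ (Fin n) → EuclideanSpace ℝ (Fin n)},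
      MemLp f (ENNReal.ofReal p) ν → Integrable (fun x => ‖f x‖ ^ p) ν := by
    intro f hf
    have := hf.integrable_norm_rpow (by simpa using by linarith) ENNReal.ofReal_ne_top
    rwa [ENNReal.toReal_ofReal (by linarith)] at this
  have hE := h.energy_sub_eq hΩ hp ha hab
  have hI := h.inner_eq hΩ hp hs ha.le hab
  have hFi := h.intervalIntegrable_dissipation hp ha.le hab
  have hGi := h.intervalIntegrable_flux_inner hp ha.le hab hs.memLp_gradient
  -- Tangent inequality based at `g τ x` and compared with `g s x`, integrated in space and time.
  -- Its mixed term is the flux tested against the frozen function `u s`.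
  have key : ∫ τ in a..b, ((∫ x, ‖g τ x‖ ^ p ∂ν) - D) ≤ ∫ τ in a..b,
      p * ((∫ x, ‖g τ x‖ ^ p ∂ν) - ∫ x, inner ℝ (‖g τ x‖ ^ (p - 2) • g τ x) (g s x) ∂ν) := by
    have hi1 := (hFi.sub (intervalIntegrable_const (c := D)))
    have hi2 := (hFi.sub hGi).const_mul p
    rw [intervalIntegrable_iff_integrableOn_Ioc_of_le hab] at hi1 hi2
    rw [intervalIntegral.integral_of_le hab, intervalIntegral.integral_of_le hab]
    refine integral_mono_ae hi1 hi2 ?_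
    rw [EventuallyLE, ae_restrict_iff' measurableSet_Ioc]
    filter_upwards [(ae_restrict_iff' measurableSet_Ioi).1 h.hasSobolevZeroGradient,
      (ae_restrict_iff' measurableSet_Ioi).1 (h.ae_memLp_flux hp)] with τ h1 h2 hτ
    have hτ0 : τ ∈ Ioi (0 : ℝ) := ha.trans hτ.1
    have hg1 := (h1 hτ0).memLp_gradient
    have hg2 := h2 hτ0
    have hi3 := integrable_inner_of_memLp hg2 hs.memLp_gradient
    rw [hD, ← integral_sub (hpow hg1) (hpow hs.memLp_gradient), ← integral_sub (hpow hg1) hi3,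
      ← integral_const_mul]
    refine integral_mono ((hpow hg1).sub (hpow hs.memLp_gradient))
      (((hpow hg1).sub hi3).const_mul p) fun x => ?_
    have := norm_rpow_sub_norm_rpow_le hp (g τ x) (g s x)
    rwa [inner_sub_right, inner_norm_rpow_smul_self hp] at this
  rw [intervalIntegral.integral_sub hFi intervalIntegrable_const,
    intervalIntegral.integral_const_mul, intervalIntegral.integral_sub hFi hGi,
    intervalIntegral.integral_const, smul_eq_mul] at key
  have h1 : (∫ τ in a..b, ∫ x, ‖g τ x‖ ^ p ∂ν) = l2Energy u a - l2Energy u b := by linarith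
  -- The energy drop equals the product of `u a - u b` with the midpoint, so it combines with the
  -- tested equation into one inner product.
  have h2 : (inner ℝ (u a - u b) ((1 / 2 : ℝ) • (u a + u b) - u s) : ℝ)
      = (l2Energy u a - l2Energy u b) + (inner ℝ (u b) (u s) - inner ℝ (u a) (u s)) := by
    simp only [l2Energy, inner_sub_right, inner_sub_left, inner_smul_right, inner_add_right,
      real_inner_self_eq_norm_sq, real_inner_comm (u a) (u b)]
    ring
  rw [h2, hI]
  rw [h1] at key
  linarith

end WeakEvolution

/-! ### Regularity of the dissipation and differentiability of the energy. -/

namespace WeakEvolution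

variable {n : ℕ} {Ω : Opens (EuclideanSpace ℝ (Fin n))} {p : ℝ} {u : ℝ → L2Space Ω}
  {g : ℝ → EuclideanSpace ℝ (Fin n) → EuclideanSpace ℝ (Fin n)}

/-- Lebesgue differentiation of the energy identity; the exceptional null set is removed later. -/
theorem ae_hasDerivAt_energy (h : WeakEvolution Ω p u g fun t x => ‖g t x‖ ^ (p - 2) • g t x)
    (hΩ : Bornology.IsBounded (Ω : Set (EuclideanSpace ℝ (Fin n)))) (hp : 2 < p) {c d : ℝ}
    (hc : 0 < c) (hcd : c ≤ d) :
    ∀ᵐ a, a ∈ Ioo c d → HasDerivAt (l2Energy u)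
      (-∫ x in (Ω : Set (EuclideanSpace ℝ (Fin n))), ‖g a x‖ ^ p) a := by
  filter_upwards [(h.intervalIntegrable_dissipation hp hc.le hcd).ae_hasDerivAt_integral]
    with a ha hacd
  rw [uIcc_of_le hcd] at ha
  have h1 := ((ha (Ioo_subset_Icc_self hacd) c (left_mem_Icc.2 hcd)).const_sub (l2Energy u c))
  refine h1.congr_of_eventuallyEq ?_
  filter_upwards [Ioo_mem_nhds hacd.1 hacd.2] with b hb
  have := h.energy_sub_eq hΩ hp hc hb.1.le
  linarith

/-- The dissipation is Lipschitz in time, up to a null set of times. -/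
theorem exists_dissipation_lipschitz
    (h : WeakEvolution Ω p u g fun t x => ‖g t x‖ ^ (p - 2) • g t x)
    (hΩ : Bornology.IsBounded (Ω : Set (EuclideanSpace ℝ (Fin n)))) (hp : 2 < p) {c d : ℝ}
    (hc : 0 < c) (hcd : c ≤ d) :
    ∃ (K : NNReal) (F : ℝ → ℝ), LipschitzWith K F ∧ ∀ᵐ a, a ∈ Ioo c d →
      F a = ∫ x in (Ω : Set (EuclideanSpace ℝ (Fin n))), ‖g a x‖ ^ p := by
  set D : ℝ → ℝ := fun a => ∫ x in (Ω : Set (EuclideanSpace ℝ (Fin n))), ‖g a x‖ ^ p with hD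
  obtain ⟨L, hL0, hL⟩ := h.exists_lipschitz hΩ hp hc d
  set S : Set ℝ := {s | s ∈ Ioo c d ∧ HasDerivAt (l2Energy u) (-D s) s ∧ ∀ a b, 0 < a → a ≤ b →
      l2Energy u a - l2Energy u b
        ≤ (b - a) * D s + p * inner ℝ (u a - u b) ((1 / 2 : ℝ) • (u a + u b) - u s)} with hS
  have hae : ∀ᵐ s, s ∈ Ioo c d → s ∈ S := by
    filter_upwards [h.ae_hasDerivAt_energy hΩ hp hc hcd,
      (ae_restrict_iff' measurableSet_Ioi).1 (h.energy_drop_le hΩ hp)] with s h1 h2 hs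
    exact ⟨hs, h1 hs, h2 (hc.trans hs.1)⟩
  -- Divide the energy drop on `[a, b]` by `b - a` and let `b` decrease to `a`. Both factors of the
  -- inner product are bounded by the Lipschitz constant of `u`: the first is `O(b - a)`, the second
  -- `O(|a - s| + (b - a))`.
  have hle : ∀ a ∈ S, ∀ s ∈ S, D a ≤ D s + p * L ^ 2 * |a - s| := by
    intro a ha s hs
    have h1 : Tendsto (fun b => -slope (l2Energy u) a b) (𝓝[>] a) (𝓝 (D a)) := by
      have := (hasDerivWithinAt_iff_tendsto_slope' (s := Ioi a) (by simp)).1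
        ha.2.1.hasDerivWithinAt
      simpa using this.neg
    have h2 : Tendsto (fun b => D s + p * L * (L * |a - s| + L * (b - a))) (𝓝[>] a)
        (𝓝 (D s + p * L * (L * |a - s| + L * (a - a)))) :=
      (Continuous.tendsto (by fun_prop) a).mono_left nhdsWithin_le_nhds
    have h3 : D a ≤ D s + p * L * (L * |a - s| + L * (a - a)) := by
      refine le_of_tendsto_of_tendsto h1 h2 ?_
      filter_upwards [Ioo_mem_nhdsGT ha.1.2] with b hb
      have hab : 0 < b - a := sub_pos.2 hb.1
      have hb' : b ∈ Icc c d := ⟨ha.1.1.le.trans hb.1.le, hb.2.le⟩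
      have ha' : a ∈ Icc c d := Ioo_subset_Icc_self ha.1
      have hs' : s ∈ Icc c d := Ioo_subset_Icc_self hs.1
      have e1 := hs.2.2 a b (hc.trans ha.1.1) hb.1.le
      have e2 : ‖u a - u b‖ ≤ L * (b - a) := by
        have := hL b hb' a ha'
        rwa [abs_sub_comm, abs_of_pos hab] at this
      have e3 : ‖(1 / 2 : ℝ) • (u a + u b) - u s‖ ≤ L * |a - s| + L * (b - a) := by
        have : (1 / 2 : ℝ) • (u a + u b) - u s = (u a - u s) + (1 / 2 : ℝ) • (u b - u a) := by
          module
        rw [this]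
        refine (norm_add_le _ _).trans (add_le_add (hL s hs' a ha') ?_)
        rw [norm_smul, norm_sub_rev]
        norm_num
        linarith [norm_nonneg (u a - u b)]
      have e4 : (inner ℝ (u a - u b) ((1 / 2 : ℝ) • (u a + u b) - u s) : ℝ)
          ≤ L * (b - a) * (L * |a - s| + L * (b - a)) :=
        (real_inner_le_norm _ _).trans (mul_le_mul e2 e3 (norm_nonneg _) (by positivity))
      have e5 : l2Energy u a - l2Energy u b
          ≤ (b - a) * (D s + p * L * (L * |a - s| + L * (b - a))) := by
        have := mul_le_mul_of_nonneg_left e4 (by linarith : 0 ≤ p)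
        linarith
      rw [slope_def_field, ← neg_div, neg_sub, div_le_iff₀ hab]
      linarith
    calc D a ≤ _ := h3
      _ = D s + p * L ^ 2 * |a - s| := by ring
  have hLip : LipschitzOnWith (Real.toNNReal (p * L ^ 2)) D S :=
    LipschitzOnWith.of_le_add_mul _ fun a ha s hs => by
      rw [Real.coe_toNNReal _ (mul_nonneg (by linarith) (sq_nonneg L)), Real.dist_eq]
      exact hle a ha s hs
  obtain ⟨F, hF, hFS⟩ := hLip.extend_real
  refine ⟨_, F, hF, ?_⟩
  filter_upwards [hae] with a ha hacd using (hFS (ha hacd)).symm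

theorem continuousOn_energy {G : ℝ → EuclideanSpace ℝ (Fin n) → EuclideanSpace ℝ (Fin n)}
    (h : WeakEvolution Ω p u g G) : ContinuousOn (l2Energy u) (Ici 0) :=
  continuousOn_const.mul (h.continuousOn.norm.pow 2)

/-- An a.e. lower bound of the dissipation by the energy gives the energy inequality at all
times. -/
theorem exists_hasDerivAt_energy
    (h : WeakEvolution Ω p u g fun t x => ‖g t x‖ ^ (p - 2) • g t x)
    (hΩ : Bornology.IsBounded (Ω : Set (EuclideanSpace ℝ (Fin n)))) (hp : 2 < p) {κ : ℝ}
    (hκ : ∀ᵐ t ∂(volume.restrict (Ioi (0 : ℝ))), κ * l2Energy u t ^ (p / 2)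
      ≤ ∫ x in (Ω : Set (EuclideanSpace ℝ (Fin n))), ‖g t x‖ ^ p) {t : ℝ} (ht : 0 < t) :
    ∃ D : ℝ, HasDerivAt (l2Energy u) (-D) t ∧ κ * l2Energy u t ^ (p / 2) ≤ D := by
  have hc : 0 < t / 2 := by linarith
  -- The time window around `t` stays away from `0`, where the Lipschitz bound may degenerate.
  obtain ⟨K, F, hF, hFD⟩ := h.exists_dissipation_lipschitz hΩ hp hc
    (by linarith : t / 2 ≤ 2 * t)
  have htm : t ∈ Ioo (t / 2) (2 * t) := ⟨by linarith, by linarith⟩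
  have hFc := hF.continuous
  refine ⟨F t, ?_, ?_⟩
  · have h1 : HasDerivAt (fun b => ∫ τ in (t / 2)..b, F τ) (F t) t :=
      intervalIntegral.integral_hasDerivAt_right (hFc.intervalIntegrable _ _)
        hFc.stronglyMeasurable.stronglyMeasurableAtFilter hFc.continuousAt
    refine (h1.const_sub (l2Energy u (t / 2))).congr_of_eventuallyEq ?_
    filter_upwards [Ioo_mem_nhds htm.1 htm.2] with b hb
    have h2 := h.energy_sub_eq hΩ hp hc hb.1.le
    have h3 : (∫ τ in (t / 2)..b, F τ) = ∫ τ in (t / 2)..b,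
        ∫ x in (Ω : Set (EuclideanSpace ℝ (Fin n))), ‖g τ x‖ ^ p := by
      refine intervalIntegral.integral_congr_ae ?_
      rw [uIoc_of_le hb.1.le]
      filter_upwards [hFD] with τ h4 hτ using h4 ⟨hτ.1, hτ.2.trans_lt hb.2⟩
    linarith
  · have hE : ContinuousAt (fun t => κ * l2Energy u t ^ (p / 2)) t :=
      continuousAt_const.mul (((h.continuousOn_energy).continuousAt (Ici_mem_nhds ht)).rpow_const
        (.inr (by linarith)))
    -- Both sides are continuous at `t`, so a strict failure there would persist on a neighbourhood,
    -- which meets the dense full-measure set where the bound holds.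
    by_contra! hlt
    have hev := (hFc.continuousAt.eventually_lt hE hlt).and (Ioo_mem_nhds htm.1 htm.2)
    have hdense := Measure.dense_of_ae (hFD.and ((ae_restrict_iff' measurableSet_Ioi).1 hκ))
    obtain ⟨τ, hτ1, hτ2⟩ := mem_closure_iff_nhds.1 (hdense t) _ hev
    obtain ⟨h5, h6⟩ := hτ1
    have h7 := hτ2.2 (hc.trans h6.1)
    rw [← hτ2.1 h6] at h7
    exact absurd h5 (not_lt.2 h7)

end WeakEvolution

/-! ### Poincaré's inequality. -/

section Poincare

variable {n : ℕ} {Ω : Opens (EuclideanSpace ℝ (Fin n))} {p : ℝ}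

theorem norm_gradient_eq_norm_fderiv (f : EuclideanSpace ℝ (Fin n) → ℝ)
    (x : EuclideanSpace ℝ (Fin n)) : ‖gradient f x‖ = ‖fderiv ℝ f x‖ := by
  simp [gradient]

theorem testFunction_eq_zero_of_notMem (v : 𝓓(Ω, ℝ)) {x : EuclideanSpace ℝ (Fin n)}
    (hx : x ∉ (Ω : Set (EuclideanSpace ℝ (Fin n)))) : v x = 0 :=
  image_eq_zero_of_notMem_tsupport fun h => hx (v.tsupport_subset h)

theorem gradient_testFunction_eq_zero_of_notMem (v : 𝓓(Ω, ℝ)) {x : EuclideanSpace ℝ (Fin n)}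
    (hx : x ∉ (Ω : Set (EuclideanSpace ℝ (Fin n)))) : gradient v x = 0 := by
  rw [← norm_eq_zero, norm_gradient_eq_norm_fderiv, norm_eq_zero]
  by_contra h
  exact hx (v.tsupport_subset (support_fderiv_subset ℝ h))

/-- Poincaré's inequality for test functions. -/
theorem integral_sq_testFunction_le (hn : 1 ≤ n) {R : ℝ}
    (hΩ : ∀ x ∈ (Ω : Set (EuclideanSpace ℝ (Fin n))), ‖x‖ ≤ R) (v : 𝓓(Ω, ℝ)) :
    ∫ x in (Ω : Set (EuclideanSpace ℝ (Fin n))), ‖v x‖ ^ 2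
      ≤ (2 * R) ^ 2 * ∫ x in (Ω : Set (EuclideanSpace ℝ (Fin n))), ‖gradient v x‖ ^ 2 := by
  rw [setIntegral_eq_integral_of_forall_compl_eq_zero
      (fun x hx => by simp [testFunction_eq_zero_of_notMem v hx]),
    setIntegral_eq_integral_of_forall_compl_eq_zero
      (fun x hx => by simp [gradient_testFunction_eq_zero_of_notMem v hx])]
  let i : Fin n := ⟨0, hn⟩
  let e : EuclideanSpace ℝ (Fin n) := EuclideanSpace.single i 1
  let l : EuclideanSpace ℝ (Fin n) →L[ℝ] ℝ := EuclideanSpace.proj i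
  have he : ‖e‖ = 1 := by simp [e]
  have hle : l e = 1 := by simp [l, e]
  have hl : ∀ x, |l x| ≤ ‖x‖ := fun x => by
    simpa [l] using PiLp.norm_apply_le x i
  have hvd : ∀ x, DifferentiableAt ℝ v x := v.contDiff.differentiable (by simp)
  have hvc : Continuous v := v.continuous
  have hgc := continuous_gradient_testFunction v
  have hfc : Continuous fun x => fderiv ℝ v x e :=
    (v.contDiff.continuous_fderiv (by simp)).clm_apply continuous_const
  have hf' : ∀ x, HasFDerivAt (fun x => v x ^ 2) ((2 * v x) • fderiv ℝ v x) x := fun x => by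
    simpa using (hvd x).hasFDerivAt.pow 2
  have hI : ∀ {φ : EuclideanSpace ℝ (Fin n) → ℝ}, Continuous φ → (∀ x, v x = 0 → φ x = 0) →
      Integrable φ := fun hφ h0 =>
    hφ.integrable_of_hasCompactSupport (v.hasCompactSupport.mono fun x hx hv => hx (h0 x hv))
  have hgi : Integrable fun x => ‖gradient v x‖ ^ 2 := by
    have := (memLp_gradient_testFunction v 2 volume).integrable_norm_pow (by norm_num)
    simpa using this
  have hvi : Integrable fun x => ‖v x‖ ^ 2 := hI (by fun_prop) fun x hx => by simp [hx]
  have hfd : ∀ x, fderiv ℝ (fun x => v x ^ 2) x e = 2 * v x * fderiv ℝ v x e := fun x => by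
    rw [(hf' x).fderiv]; simp
  -- Integrate by parts against the coordinate `l`, whose derivative along `e` is `1`: this writes
  -- `∫ v²` as `-∫ 2 v (∂ₑ v) l`, where `|l| ≤ R` on the domain.
  have hparts := integral_mul_fderiv_eq_neg_fderiv_mul_of_integrable (μ := volume)
    (f := fun x => v x ^ 2) (g := l) (v := e) ?_ ?_ ?_ (fun x _ => (hf' x).differentiableAt)
    (fun x _ => l.differentiableAt)
  · simp only [hfd, ContinuousLinearMap.fderiv, hle, mul_one] at hparts
    have hmain : ∫ x, ‖v x‖ ^ 2
        ≤ ∫ x, (1 / 2 * ‖v x‖ ^ 2 + 2 * R ^ 2 * ‖gradient v x‖ ^ 2) := by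
      simp only [Real.norm_eq_abs (v _), sq_abs]
      rw [hparts, ← integral_neg]
      refine integral_mono (hI (by fun_prop) fun x hx => by simp [hx]).neg ?_ fun x => ?_
      · have hvi' : Integrable fun x => v x ^ 2 := hI (by fun_prop) fun x hx => by simp [hx]
        exact (hvi'.const_mul (1 / 2)).add (hgi.const_mul (2 * R ^ 2))
      · by_cases hx : x ∈ (Ω : Set (EuclideanSpace ℝ (Fin n)))
        · have h1 : |fderiv ℝ v x e| ≤ ‖gradient v x‖ := by
            rw [norm_gradient_eq_norm_fderiv]
            simpa [he] using (fderiv ℝ v x).le_opNorm e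
          have h2 : |fderiv ℝ v x e * l x| ≤ ‖gradient v x‖ * R := by
            rw [abs_mul]
            exact mul_le_mul h1 ((hl x).trans (hΩ x hx)) (abs_nonneg _) (norm_nonneg _)
          have h3 : (fderiv ℝ v x e * l x) ^ 2 ≤ (‖gradient v x‖ * R) ^ 2 :=
            sq_le_sq' (by linarith [neg_abs_le (fderiv ℝ v x e * l x)])
              ((le_abs_self _).trans h2)
          change -(2 * v x * fderiv ℝ v x e * l x) ≤ 1 / 2 * v x ^ 2 + 2 * R ^ 2 * ‖gradient v x‖ ^ 2
          -- The weights in this square leave `½ v²`, which is absorbed on the left; doubling `2 R²`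
          -- gives the constant `(2 R)²`.
          nlinarith [sq_nonneg (v x + 2 * (fderiv ℝ v x e * l x))]
        · have h0 := testFunction_eq_zero_of_notMem v hx
          simp only [h0]
          simp only [mul_zero, zero_mul, neg_zero]
          positivity
    rw [integral_add (hvi.const_mul _) (hgi.const_mul _), integral_const_mul,
      integral_const_mul] at hmain
    linarith
  · simp only [hfd]
    exact hI (by fun_prop) fun x hx => by simp [hx]
  · simp only [ContinuousLinearMap.fderiv, hle, mul_one]
    exact hI (by fun_prop) fun x hx => by simp [hx]
  · exact hI (by fun_prop) fun x hx => by simp [hx]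

theorem eLpNorm_testFunction_le (hn : 1 ≤ n) {R : ℝ} (hR : 0 ≤ R)
    (hΩ : ∀ x ∈ (Ω : Set (EuclideanSpace ℝ (Fin n))), ‖x‖ ≤ R) (v : 𝓓(Ω, ℝ)) :
    eLpNorm v 2 (volume.restrict (Ω : Set (EuclideanSpace ℝ (Fin n))))
      ≤ ENNReal.ofReal (2 * R) *
        eLpNorm (gradient v) 2 (volume.restrict (Ω : Set (EuclideanSpace ℝ (Fin n)))) := by
  have h := integral_sq_testFunction_le hn hΩ v
  rw [(memLp_testFunction v 2 _).eLpNorm_eq_integral_rpow_norm (by norm_num) (by norm_num),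
    (memLp_gradient_testFunction v 2 _).eLpNorm_eq_integral_rpow_norm (by norm_num) (by norm_num),
    ← ENNReal.ofReal_mul (by positivity)]
  refine ENNReal.ofReal_le_ofReal ?_
  have h2 : (2 : ℝ≥0∞).toReal = 2 := by simp
  simp only [h2, Real.rpow_two]
  rw [show (2 : ℝ)⁻¹ = 1 / 2 by norm_num, ← Real.sqrt_eq_rpow, ← Real.sqrt_eq_rpow]
  refine Real.sqrt_le_iff.2 ⟨by positivity, ?_⟩
  rwa [mul_pow, Real.sq_sqrt (integral_nonneg fun x => by positivity)]

/-- Poincaré's inequality in `W₀^{1,p}(Ω)`, with the `L²` norm on the left. -/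
theorem exists_eLpNorm_two_le (hn : 1 ≤ n)
    (hΩ : Bornology.IsBounded (Ω : Set (EuclideanSpace ℝ (Fin n)))) (hp : 2 < p) :
    ∃ C : ℝ≥0∞, C ≠ ∞ ∧ ∀ f g, HasSobolevZeroGradient Ω p f g →
      eLpNorm f 2 (volume.restrict (Ω : Set (EuclideanSpace ℝ (Fin n))))
        ≤ C * eLpNorm g (ENNReal.ofReal p)
          (volume.restrict (Ω : Set (EuclideanSpace ℝ (Fin n)))) := by
  obtain ⟨R, hR, hΩR⟩ := hΩ.exists_pos_norm_le
  have hfin : IsFiniteMeasure (volume.restrict (Ω : Set (EuclideanSpace ℝ (Fin n)))) :=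
    ⟨by simpa using hΩ.measure_lt_top⟩
  set ν := volume.restrict (Ω : Set (EuclideanSpace ℝ (Fin n))) with hν
  set M : ℝ≥0∞ := ν univ ^ (1 / (2 : ℝ≥0∞).toReal - 1 / (ENNReal.ofReal p).toReal) with hM
  have hMtop : M ≠ ∞ := by
    refine ENNReal.rpow_ne_top_of_nonneg ?_ (measure_ne_top _ _)
    rw [ENNReal.toReal_ofReal (by linarith), sub_nonneg]
    exact one_div_le_one_div_of_le (by norm_num) (by simpa using hp.le)
  have h2p : (2 : ℝ≥0∞) ≤ ENNReal.ofReal p := by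
    simpa using ENNReal.ofReal_le_ofReal hp.le
  have hP1 : (1 : ℝ≥0∞) ≤ ENNReal.ofReal p := le_trans (by norm_num) h2p
  have hCtop : ENNReal.ofReal (2 * R) * M ≠ ∞ := ENNReal.mul_ne_top ENNReal.ofReal_ne_top hMtop
  refine ⟨ENNReal.ofReal (2 * R) * M, hCtop, fun f g hfg => ?_⟩
  obtain ⟨φ, h1, h2⟩ := hfg.exists_approx
  have hgr : ∀ k, MemLp (gradient (φ k)) (ENNReal.ofReal p) ν :=
    fun k => memLp_gradient_testFunction _ _ _
  have hbound : ∀ k, eLpNorm f 2 ν ≤ eLpNorm (fun x => f x - φ k x) (ENNReal.ofReal p) ν * M +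
      ENNReal.ofReal (2 * R) * M * (eLpNorm (fun x => g x - gradient (φ k) x) (ENNReal.ofReal p) ν
        + eLpNorm g (ENNReal.ofReal p) ν) := by
    intro k
    have hd := hfg.memLp.sub (memLp_testFunction (φ k) (ENNReal.ofReal p) ν)
    have e1 : eLpNorm f 2 ν ≤ eLpNorm (fun x => f x - φ k x) 2 ν + eLpNorm (φ k) 2 ν := by
      have := eLpNorm_add_le (μ := ν) hd.1 (memLp_testFunction (φ k) 2 ν).1
        (by norm_num : (1 : ℝ≥0∞) ≤ 2)
      rwa [sub_add_cancel] at this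
    have e2 : eLpNorm (fun x => f x - φ k x) 2 ν
        ≤ eLpNorm (fun x => f x - φ k x) (ENNReal.ofReal p) ν * M :=
      eLpNorm_le_eLpNorm_mul_rpow_measure_univ h2p hd.1
    have e3 : eLpNorm (gradient (φ k)) 2 ν ≤ eLpNorm (gradient (φ k)) (ENNReal.ofReal p) ν * M :=
      eLpNorm_le_eLpNorm_mul_rpow_measure_univ h2p (hgr k).1
    have e4 : eLpNorm (gradient (φ k)) (ENNReal.ofReal p) ν
        ≤ eLpNorm (fun x => g x - gradient (φ k) x) (ENNReal.ofReal p) ν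
          + eLpNorm g (ENNReal.ofReal p) ν := by
      have := eLpNorm_sub_le (μ := ν) hfg.memLp_gradient.1 (hfg.memLp_gradient.sub (hgr k)).1 hP1
      rw [sub_sub_cancel, add_comm] at this
      exact this
    refine e1.trans (add_le_add e2 ((eLpNorm_testFunction_le hn hR.le hΩR (φ k)).trans ?_))
    rw [mul_assoc]
    refine mul_le_mul_right (e3.trans ?_) _
    rw [mul_comm]
    exact mul_le_mul_right e4 _
  have hlim := (ENNReal.Tendsto.mul_const h1 (.inr hMtop)).add
    (ENNReal.Tendsto.const_mul (h2.add (tendsto_const_nhds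
      (x := eLpNorm g (ENNReal.ofReal p) ν))) (.inr hCtop))
  have := ge_of_tendsto' hlim hbound
  simpa using this

/-- Poincaré's inequality raised to the power `p`; the factor `½` in the energy is simply discarded.
-/
theorem exists_energy_le_dissipation (hn : 1 ≤ n)
    (hΩ : Bornology.IsBounded (Ω : Set (EuclideanSpace ℝ (Fin n)))) (hp : 2 < p) :
    ∃ κ : ℝ, 0 < κ ∧ ∀ (a : L2Space Ω) (g : EuclideanSpace ℝ (Fin n) → EuclideanSpace ℝ (Fin n)),
      HasSobolevZeroGradient Ω p a g → κ * (1 / 2 * ‖a‖ ^ 2) ^ (p / 2)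
        ≤ ∫ x in (Ω : Set (EuclideanSpace ℝ (Fin n))), ‖g x‖ ^ p := by
  obtain ⟨C, hC, hCle⟩ := exists_eLpNorm_two_le hn hΩ hp
  have hp0 : 0 < p := by linarith
  -- Adding `1` ensures a positive constant, so that `B ^ p` can be inverted.
  set B := C.toReal + 1 with hB
  have hB0 : 0 < B := by positivity
  refine ⟨(B ^ p)⁻¹, by positivity, fun a g hag => ?_⟩
  have h1 := ENNReal.toReal_mono (ENNReal.mul_ne_top hC hag.memLp_gradient.2.ne) (hCle a g hag)
  rw [← Lp.norm_def, ENNReal.toReal_mul, hag.memLp_gradient.eLpNorm_eq_integral_rpow_norm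
    (by simpa using hp0) ENNReal.ofReal_ne_top, ENNReal.toReal_ofReal (by positivity),
    ENNReal.toReal_ofReal hp0.le] at h1
  set D := ∫ x in (Ω : Set (EuclideanSpace ℝ (Fin n))), ‖g x‖ ^ p with hD
  have hD0 : 0 ≤ D := integral_nonneg fun x => by positivity
  have h2 : ‖a‖ ≤ B * D ^ p⁻¹ := h1.trans (by gcongr; linarith)
  have h3 : ‖a‖ ^ p ≤ B ^ p * D := by
    have := Real.rpow_le_rpow (norm_nonneg a) h2 hp0.le
    rwa [Real.mul_rpow hB0.le (by positivity), ← Real.rpow_mul hD0, inv_mul_cancel₀ hp0.ne',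
      Real.rpow_one] at this
  have h4 : (1 / 2 * ‖a‖ ^ 2) ^ (p / 2) ≤ ‖a‖ ^ p := by
    calc (1 / 2 * ‖a‖ ^ 2) ^ (p / 2) ≤ (‖a‖ ^ 2) ^ (p / 2) := by
          refine Real.rpow_le_rpow (by positivity) ?_ (by positivity)
          linarith [sq_nonneg ‖a‖]
      _ = ‖a‖ ^ p := by
          rw [← Real.rpow_natCast, ← Real.rpow_mul (norm_nonneg a)]
          congr 1
          push_cast
          ring
  rw [inv_mul_le_iff₀ (by positivity)]
  exact h4.trans h3

end Poincare

/-! ### The differential inequality and the decay rates. -/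

/-- Decay of nonnegative solutions of the differential inequality `E' + C E^{p/2} ≤ 0`. -/
theorem le_of_hasDerivAt_rpow {E : ℝ → ℝ} {C p : ℝ} (hC : 0 < C) (hp : 2 < p)
    (hE0 : ∀ t, 0 ≤ E t) (hEc : ContinuousOn E (Ici 0))
    (hE : ∀ t, 0 < t → ∃ D, HasDerivAt E (-D) t ∧ C * E t ^ (p / 2) ≤ D) {t : ℝ} (ht : 0 < t) :
    E t ≤ (C * ((p - 2) / 2)) ^ (-(2 / (p - 2))) * t ^ (-(2 / (p - 2))) := by
  have hp2 : 0 < p - 2 := by linarith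
  set k := C * ((p - 2) / 2) with hk
  have hk0 : 0 < k := by positivity
  -- If `E t > 0`, monotonicity makes `E` positive on all of `[0, t]`, where negative powers may be
  -- differentiated.
  rcases (hE0 t).eq_or_lt with h0 | h0
  · rw [← h0]; positivity
  choose! D hD hCD using hE
  have hanti : AntitoneOn E (Ici 0) := by
    refine antitoneOn_of_hasDerivWithinAt_nonpos (f' := fun t => -D t) (convex_Ici 0) hEc ?_ ?_
    · intro x hx
      rw [interior_Ici] at hx
      exact (hD x hx).hasDerivWithinAt
    · intro x hx
      rw [interior_Ici] at hx
      have := hCD x hx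
      have := Real.rpow_nonneg (hE0 x) (p / 2)
      nlinarith
  have hpos : ∀ s ∈ Icc 0 t, 0 < E s := fun s hs =>
    h0.trans_le (hanti hs.1 (mem_Ici.2 ht.le) hs.2)
  -- The power `-(p - 2) / 2` linearises the inequality: the derivative of `E` to this power is at
  -- least `k`. Discarding the initial term afterwards makes the bound independent of `E 0`.
  have hmono : MonotoneOn (fun s => E s ^ (-((p - 2) / 2)) - k * s) (Icc 0 t) := by
    refine monotoneOn_of_hasDerivWithinAt_nonneg
      (f' := fun s => -D s * (-((p - 2) / 2)) * E s ^ (-((p - 2) / 2) - 1) - k * 1)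
      (convex_Icc 0 t) ?_ ?_ ?_
    · refine ContinuousOn.sub ?_ (by fun_prop)
      exact (hEc.mono Icc_subset_Ici_self).rpow_const fun s hs => .inl (hpos s hs).ne'
    · intro s hs
      rw [interior_Icc] at hs
      exact (((hD s hs.1).rpow_const (.inl (hpos s (Ioo_subset_Icc_self hs)).ne')).sub
        ((hasDerivAt_id s).const_mul k)).hasDerivWithinAt
    · intro s hs
      rw [interior_Icc] at hs
      have hEs := hpos s (Ioo_subset_Icc_self hs)
      have h1 : E s ^ (p / 2) * E s ^ (-((p - 2) / 2) - 1) = 1 := by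
        rw [← Real.rpow_add hEs, show p / 2 + (-((p - 2) / 2) - 1) = 0 by ring, Real.rpow_zero]
      have h2 : C * 1 ≤ D s * E s ^ (-((p - 2) / 2) - 1) := by
        calc C * 1 = C * E s ^ (p / 2) * E s ^ (-((p - 2) / 2) - 1) := by rw [mul_assoc, h1]
          _ ≤ _ := mul_le_mul_of_nonneg_right (hCD s hs.1) (by positivity)
      have h3 := mul_le_mul_of_nonneg_left h2 (by positivity : 0 ≤ (p - 2) / 2)
      rw [hk]
      linarith
  have h1 := hmono (left_mem_Icc.2 ht.le) (right_mem_Icc.2 ht.le) ht.le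
  have h2 : 0 < E 0 ^ (-((p - 2) / 2)) := Real.rpow_pos_of_pos (hpos 0 (left_mem_Icc.2 ht.le)) _
  have h3 : k * t ≤ E t ^ (-((p - 2) / 2)) := by
    simp only [mul_zero, sub_zero] at h1
    linarith
  have h4 := Real.rpow_le_rpow_of_nonpos (z := -(2 / (p - 2))) (by positivity) h3
    (by rw [neg_nonpos]; positivity)
  rw [← Real.rpow_mul h0.le, show -((p - 2) / 2) * -(2 / (p - 2)) = 1 by field_simp,
    Real.rpow_one, Real.mul_rpow hk0.le ht.le] at h4
  exact h4

theorem mainTheorem10 {n : ℕ} (hn : 1 ≤ n) (Ω : Opens (EuclideanSpace ℝ (Fin n)))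
    (hΩ : Bornology.IsBounded (Ω : Set (EuclideanSpace ℝ (Fin n)))) (p : ℝ) (hp : 2 < p) :
    (∃ C : ℝ, 0 < C ∧ ∀ (u₀ : L2Space Ω) (u : ℝ → L2Space Ω),
      IsParabolicPLaplaceSolution Ω p u₀ u → ∀ t : ℝ, 0 < t →
        DifferentiableAt ℝ (l2Energy u) t ∧
          deriv (l2Energy u) t + C * l2Energy u t ^ (p / 2) ≤ 0) ∧
    (∃ C : ℝ, 0 < C ∧ ∀ (u₀ : L2Space Ω) (u : ℝ → L2Space Ω),
      IsParabolicPLaplaceSolution Ω p u₀ u → ∀ t : ℝ, 0 < t →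
        l2Energy u t ≤ C * t ^ (-(2 / (p - 2)))) ∧
    (∃ C : ℝ, 0 < C ∧ ∀ (u₀ : L2Space Ω) (u : ℝ → L2Space Ω),
      IsParabolicPLaplaceSolution Ω p u₀ u → ∀ t : ℝ, 0 < t →
        ‖u t‖ ≤ C * t ^ (-(1 / (p - 2)))) := by
  have hp2 : 0 < p - 2 := by linarith
  obtain ⟨κ, hκ, hκle⟩ := exists_energy_le_dissipation (Ω := Ω) hn hΩ hp
  have hderiv : ∀ (u₀ : L2Space Ω) (u : ℝ → L2Space Ω), IsParabolicPLaplaceSolution Ω p u₀ u →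
      ∀ t : ℝ, 0 < t → ∃ D : ℝ, HasDerivAt (l2Energy u) (-D) t ∧
        κ * l2Energy u t ^ (p / 2) ≤ D := by
    intro u₀ u hu t ht
    obtain ⟨g, h⟩ := hu.exists_weakEvolution hp
    refine h.exists_hasDerivAt_energy hΩ hp ?_ ht
    filter_upwards [h.hasSobolevZeroGradient] with τ hτ using hκle (u τ) (g τ) hτ
  set K := (κ * ((p - 2) / 2)) ^ (-(2 / (p - 2))) with hK
  have hK0 : 0 < K := by positivity
  have hdecay : ∀ (u₀ : L2Space Ω) (u : ℝ → L2Space Ω), IsParabolicPLaplaceSolution Ω p u₀ u →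
      ∀ t : ℝ, 0 < t → l2Energy u t ≤ K * t ^ (-(2 / (p - 2))) := by
    intro u₀ u hu t ht
    refine le_of_hasDerivAt_rpow hκ hp (fun t => ?_) ?_ (hderiv u₀ u hu) ht
    · rw [l2Energy]; positivity
    · exact continuousOn_const.mul (hu.continuousOn.norm.pow 2)
  refine ⟨⟨κ, hκ, fun u₀ u hu t ht => ?_⟩, ⟨K, hK0, hdecay⟩,
    ⟨Real.sqrt (2 * K), by positivity, fun u₀ u hu t ht => ?_⟩⟩
  · obtain ⟨D, hD, hle⟩ := hderiv u₀ u hu t ht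
    refine ⟨hD.differentiableAt, ?_⟩
    rw [hD.deriv]
    linarith
  · have h1 := hdecay u₀ u hu t ht
    have h2 : ‖u t‖ ^ 2 ≤ 2 * K * t ^ (-(2 / (p - 2))) := by
      rw [l2Energy] at h1
      linarith
    have h3 : t ^ (-(2 / (p - 2))) = (t ^ (-(1 / (p - 2)))) ^ 2 := by
      rw [← Real.rpow_natCast, ← Real.rpow_mul ht.le]
      congr 1
      push_cast
      ring
    refine (sq_le_sq₀ (norm_nonneg _) (by positivity)).1 ?_
    rwa [mul_pow, Real.sq_sqrt (by positivity), ← h3]
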